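/- Let $(M,g)$ be a flat Riemannian manifold with Levi-Civita connection $\nabla$, and let $a,b,c\in\mathbb R$ be such that $\alpha:=a(a+c)-b^2\neq 0$. For $(x,u)\in TM$ and $X\in T_xM$, let $X^h$ and $X^v$ be the horizontal and vertical lifts of $X$ to $(x,u)$, and let $G=a\,g^s+b\,g^h+c\,g^v$ be the pseudo-Riemannian metric on $TM$ given by $$G(X^h,Y^h)=(a+c)\,g(X,Y),\qquad G(X^h,Y^v)=G(X^v,Y^h)=b\,g(X,Y),\qquad G(X^v,Y^v)=a\,g(X,Y),$$ where $g^s$, $g^h$, $g^v$ are the Sasaki metric, the horizontal lift and the vertical lift of $g$. For a $(1,1)$-tensor field $P$ on $M$, let ${}^*P$ and $\iota P$ be the vector fields on $TM$ given by $({}^*P)_{(x,u)}=[P(u)]^h$ and $(\iota P)_{(x,u)}=[P(u)]^v$. For a vector field $\xi$ on $M$, let $C(\xi)$ be the $(1,1)$-tensor field with $g(C(\xi)Y,W)=-g(Y,\nabla_W\xi)$ for all $Y,W$, and let $\nabla^2\xi(U,V)=\nabla_U\nabla_V\xi-\nabla_{\nabla_UV}\xi$. Let $I$ be the identity $(1,1)$-tensor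 field. All fields are smooth. A vector field $Z$ on $TM$ is homothetic for $G$ (i.e. $\mathcal L_ZG=2\lambda G$ for some constant $\lambda\in\mathbb R$) if and only if there is a constant $\lambda\in\mathbb R$ such that $Z$ can be written as $$Z=\frac1\alpha\Big\{[a\zeta-b\xi]^h+{}^*\big[a\,C(\xi)-bP+\lambda ab\,I\big]+[(a+c)\xi-b\zeta]^v+\iota\big[(a+c)P-b\,C(\xi)+\lambda(\alpha-b^2)I\big]\Big\},$$ where 1. $\zeta$ is a vector field on $M$ with $\mathcal L_\zeta g=2\lambda(a+c)g$; 2. $P$ is a $(1,1)$-tensor field on $M$ which is skew-symmetric with respect to $g$ and parallel; 3. $\xi$ is a vector field on $M$ with $\nabla^2\xi(U,V)+\nabla^2\xi(V,U)=0$ for all vector fields $U,V$ on $M$. More precisely, for each fixed $\lambda\in\mathbb R$, one has $\mathcal L_ZG=2\lambda G$ if and only if $Z$ can be written in this form with that $\lambda$. -/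

import Mathlib

open scoped Manifold ContDiff Topology Bundle

noncomputable section

namespace FlatTangent

set_option linter.unusedSectionVars false

/-! ### Vector fields and Lie derivatives on an arbitrary manifold -/

section General

variable {F : Type*} [NormedAddCommGroup F] [NormedSpace ℝ F]
  {H : Type*} [TopologicalSpace H] (J : ModelWithCorners ℝ F H)
  {N : Type*} [TopologicalSpace N] [ChartedSpace H N] [IsManifold J 1 N]

/-- The vector field `V` is smooth at (that is, near) the point `q`. -/
def SmoothAt (V : Π q : N, TangentSpace J q) (q : N) : Prop :=
  ContMDiffAt J J.tangent ∞ (fun q' => (⟨q', V q'⟩ : TangentBundle J N)) q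

/-- The vector field `V` is smooth, i.e. `V ∈ 𝔛(N)`. -/
def Smooth (V : Π q : N, TangentSpace J q) : Prop :=
  ContMDiff J J.tangent ∞ (fun q' => (⟨q', V q'⟩ : TangentBundle J N))

/-- The Lie derivative of a `(0,2)`-tensor field `T` in the direction of the vector field `Z`:
`(𝓛_Z T)(V, W) = Z (T(V, W)) - T([Z, V], W) - T(V, [Z, W])`. -/
def lieDeriv (T : Π q : N, TangentSpace J q → TangentSpace J q → ℝ)
    (Z V W : Π q : N, TangentSpace J q) (q : N) : ℝ :=
  mvfderiv J (fun q' => T q' (V q') (W q')) q (Z q)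
    - T q (VectorField.mlieBracket J Z V q) (W q)
    - T q (V q) (VectorField.mlieBracket J Z W q)

/-- `𝓛_Z T = 2 μ T`, tested at each point on all vector fields that are smooth near that point. -/
def HomotheticWith (T : Π q : N, TangentSpace J q → TangentSpace J q → ℝ) (μ : ℝ)
    (Z : Π q : N, TangentSpace J q) : Prop :=
  ∀ (q : N) (V W : Π q : N, TangentSpace J q), SmoothAt J V q → SmoothAt J W q →
    lieDeriv J T Z V W q = 2 * μ * T q (V q) (W q)

/-- `Z` is homothetic for `T`: `𝓛_Z T = 2 μ T` for some real constant `μ`. -/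
def Homothetic (T : Π q : N, TangentSpace J q → TangentSpace J q → ℝ)
    (Z : Π q : N, TangentSpace J q) : Prop :=
  ∃ μ : ℝ, HomotheticWith J T μ Z

end General

/-! ### The Levi-Civita connection of a Riemannian manifold -/

section Base

variable {E : Type*} [NormedAddCommGroup E] [NormedSpace ℝ E] [FiniteDimensional ℝ E]
  {M : Type*} [TopologicalSpace M] [ChartedSpace E M] [IsManifold 𝓘(ℝ, E) ∞ M]

variable (E M) in
/-- Smooth Riemannian metrics on `M`. -/
abbrev Metric : Type _ :=
  Bundle.ContMDiffRiemannianMetric 𝓘(ℝ, E) ∞ E (fun x : M => TangentSpace 𝓘(ℝ, E) x)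

variable (g : Metric E M)

/-- The metric, as a map from tangent vectors to linear forms, is invertible. -/
theorem metric_isInvertible (x : M) : (g.inner x).IsInvertible := by
  have key : ∀ B : E →L[ℝ] E →L[ℝ] ℝ, (∀ v, v ≠ 0 → 0 < B v v) → B.IsInvertible := by
    intro B hB
    have hinj : Function.Injective B.toLinearMap := by
      refine (injective_iff_map_eq_zero B.toLinearMap).2 fun v hv => ?_
      by_contra hne
      have h1 := hB v hne
      have h2 : B v = 0 := hv
      simp [h2] at h1
    have hdim : Module.finrank ℝ E = Module.finrank ℝ (E →L[ℝ] ℝ) := by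
      rw [← (LinearMap.toContinuousLinearMap (𝕜 := ℝ) (E := E) (F' := ℝ)).finrank_eq]
      exact Subspace.dual_finrank_eq.symm
    refine ⟨(LinearEquiv.ofInjectiveOfFinrankEq B.toLinearMap hinj hdim).toContinuousLinearEquiv, ?_⟩
    ext v w
    have h := LinearEquiv.coe_ofInjectiveOfFinrankEq B.toLinearMap hinj hdim
    exact congrArg (fun L : E →L[ℝ] ℝ => L w) (LinearMap.congr_fun h v)
  exact key (g.inner x) (g.pos x)

/-- Index raising `T*_xM → T_xM`: `sharp g x θ` is the vector with `g(sharp g x θ, w) = θ w`. -/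
def sharp (x : M) : (TangentSpace 𝓘(ℝ, E) x →L[ℝ] ℝ) →L[ℝ] TangentSpace 𝓘(ℝ, E) x :=
  (g.inner x).inverse

theorem inner_sharp (x : M) (θ : TangentSpace 𝓘(ℝ, E) x →L[ℝ] ℝ) (w : TangentSpace 𝓘(ℝ, E) x) :
    g.inner x (sharp g x θ) w = θ w := by
  obtain ⟨e, he⟩ := metric_isInvertible g x
  simp [sharp, ← he]

/-- The matrix `(g_{ij})` of the metric at the point `y`, in the preferred chart at `x`. -/
def localMetric (x y : M) : E →L[ℝ] E →L[ℝ] ℝ :=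
  (trivializationAt (E →L[ℝ] E →L[ℝ] ℝ)
    (fun y : M => TangentSpace 𝓘(ℝ, E) y →L[ℝ] TangentSpace 𝓘(ℝ, E) y →L[ℝ] ℝ) x
    ⟨y, g.inner y⟩).2

/-- `localMetric g x y v w` is `g_y(V, W)`, for the vector fields `V`, `W` with constant
components `v`, `w` in the preferred chart at `x`. -/
theorem localMetric_apply (x y : M) (hy : y ∈ (chartAt E x).source) (v w : E) :
    localMetric g x y v w = g.inner y
      ((trivializationAt E (fun y : M => TangentSpace 𝓘(ℝ, E) y) x).symm y v)
      ((trivializationAt E (fun y : M => TangentSpace 𝓘(ℝ, E) y) x).symm y w) := by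
  have h : y ∈ (trivializationAt E (fun y : M => TangentSpace 𝓘(ℝ, E) y) x).baseSet := hy
  have h' := inCoordinates_apply_eq₂ (F₁ := E) (F₂ := E) (F₃ := ℝ)
    (E₁ := fun y : M => TangentSpace 𝓘(ℝ, E) y) (E₂ := fun y : M => TangentSpace 𝓘(ℝ, E) y)
    (E₃ := fun _ : M => ℝ) (ϕ := g.inner y) (v := v) (w := w) h h (Set.mem_univ _)
  refine Eq.trans h' ?_
  simp

/-- The partial derivatives of the metric components at `x`, in the preferred chart at `x`:
`metricDeriv g x u v w` is `u^k v^i w^j ∂_k g_{ij}`. -/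
def metricDeriv (x : M) : E →L[ℝ] E →L[ℝ] E →L[ℝ] ℝ :=
  mvfderiv 𝓘(ℝ, E) (localMetric g x) x

set_option maxSynthPendingDepth 3 in
/-- `koszul D u v w = (D u v w + D v u w - D w u v) / 2`, as a trilinear form. -/
def koszul (D : E →L[ℝ] E →L[ℝ] E →L[ℝ] ℝ) : E →L[ℝ] E →L[ℝ] E →L[ℝ] ℝ :=
  (1 / 2 : ℝ) • (D + D.flip
    - ((ContinuousLinearMap.flipₗᵢ ℝ E E ℝ).toContinuousLinearEquiv :
        (E →L[ℝ] E →L[ℝ] ℝ) →L[ℝ] (E →L[ℝ] E →L[ℝ] ℝ)).comp D.flip)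

set_option maxSynthPendingDepth 3 in
theorem koszul_apply (D : E →L[ℝ] E →L[ℝ] E →L[ℝ] ℝ) (u v w : E) :
    koszul D u v w = (1 / 2) * (D u v w + D v u w - D w u v) := rfl

/-- The Christoffel symbols at `x` in the preferred chart at `x`:
`christoffel g x u v` is the vector `Γ^i_{jk} u^j v^k`, where
`g_{il} Γ^i_{jk} = (∂_j g_{kl} + ∂_k g_{jl} - ∂_l g_{jk}) / 2`. -/
def christoffel (x : M) : E →L[ℝ] E →L[ℝ] E :=
  (ContinuousLinearMap.compL ℝ E (E →L[ℝ] ℝ) E (sharp g x)).comp (koszul (metricDeriv g x))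

theorem inner_christoffel (x : M) (u v w : E) :
    g.inner x (christoffel g x u v) w =
      (1 / 2) * (metricDeriv g x u v w + metricDeriv g x v u w - metricDeriv g x w u v) :=
  (inner_sharp g x (koszul (metricDeriv g x) u v) w).trans (koszul_apply _ u v w)

/-- The derivative at `x` of the components of the vector field `Y` in the preferred chart at `x`:
`fieldDeriv Y x v` is the vector `v^j ∂_j Y^i`. -/
def fieldDeriv (Y : Π x : M, TangentSpace 𝓘(ℝ, E) x) (x : M) : E →L[ℝ] E :=
  mvfderiv 𝓘(ℝ, E)
    (fun y : M => (trivializationAt E (fun y : M => TangentSpace 𝓘(ℝ, E) y) x ⟨y, Y y⟩).2) x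

/-- The Levi-Civita connection: `cov g Y x v = ∇_v Y`, with components
`v^j ∂_j Y^i + Γ^i_{jk} v^j Y^k` in the preferred chart at `x`. -/
def cov (Y : Π x : M, TangentSpace 𝓘(ℝ, E) x) (x : M) :
    TangentSpace 𝓘(ℝ, E) x →L[ℝ] TangentSpace 𝓘(ℝ, E) x :=
  fieldDeriv Y x + (christoffel g x).flip (Y x)

/-- The vector field `∇_X Y`. -/
def nabla (X Y : Π x : M, TangentSpace 𝓘(ℝ, E) x) : Π x : M, TangentSpace 𝓘(ℝ, E) x :=
  fun x => cov g Y x (X x)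

/-- The curvature `R(X, Y) W = ∇_X ∇_Y W - ∇_Y ∇_X W - ∇_{[X, Y]} W`. -/
def curvature (X Y W : Π x : M, TangentSpace 𝓘(ℝ, E) x) : Π x : M, TangentSpace 𝓘(ℝ, E) x :=
  nabla g X (nabla g Y W) - nabla g Y (nabla g X W)
    - nabla g (VectorField.mlieBracket 𝓘(ℝ, E) X Y) W

/-- `(M, g)` is flat: its curvature tensor vanishes. -/
def Flat : Prop :=
  ∀ (x : M) (X Y W : Π x : M, TangentSpace 𝓘(ℝ, E) x), SmoothAt 𝓘(ℝ, E) X x →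
    SmoothAt 𝓘(ℝ, E) Y x → SmoothAt 𝓘(ℝ, E) W x → curvature g X Y W x = 0

/-- The metric as a `(0,2)`-tensor field. -/
def metricTensor (x : M) (v w : TangentSpace 𝓘(ℝ, E) x) : ℝ := g.inner x v w

/-- The second covariant derivative `∇²ξ(U, V) = ∇_U ∇_V ξ - ∇_{∇_U V} ξ`. -/
def nabla2 (ξ U V : Π x : M, TangentSpace 𝓘(ℝ, E) x) : Π x : M, TangentSpace 𝓘(ℝ, E) x :=
  nabla g U (nabla g V ξ) - nabla g (nabla g U V) ξ

/-- `∇²ξ` is skew-symmetric: `∇²ξ(U, V) + ∇²ξ(V, U) = 0`. -/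
def SkewNabla2 (ξ : Π x : M, TangentSpace 𝓘(ℝ, E) x) : Prop :=
  ∀ (x : M) (U V : Π x : M, TangentSpace 𝓘(ℝ, E) x), SmoothAt 𝓘(ℝ, E) U x →
    SmoothAt 𝓘(ℝ, E) V x → nabla2 g ξ U V x + nabla2 g ξ V U x = 0

/-- The `(1,1)`-tensor field `C(ξ)` determined by `g(C(ξ) Y, W) = -g(Y, ∇_W ξ)`. -/
def tensorC (ξ : Π x : M, TangentSpace 𝓘(ℝ, E) x) (x : M) :
    TangentSpace 𝓘(ℝ, E) x →L[ℝ] TangentSpace 𝓘(ℝ, E) x :=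
  -((sharp g x).comp ((ContinuousLinearMap.precomp ℝ (cov g ξ x)).comp (g.inner x)))

theorem inner_tensorC (ξ : Π x : M, TangentSpace 𝓘(ℝ, E) x) (x : M) (v w : TangentSpace 𝓘(ℝ, E) x) :
    g.inner x (tensorC g ξ x v) w = -g.inner x v (cov g ξ x w) := by
  simp [tensorC, inner_sharp]

/-- The `(1,1)`-tensor field `P` is smooth. -/
def SmoothEnd (P : Π x : M, TangentSpace 𝓘(ℝ, E) x →L[ℝ] TangentSpace 𝓘(ℝ, E) x) : Prop :=
  ContMDiff 𝓘(ℝ, E) (𝓘(ℝ, E).prod 𝓘(ℝ, E →L[ℝ] E)) ∞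
    (fun x => Bundle.TotalSpace.mk' (E →L[ℝ] E)
      (E := fun x : M => TangentSpace 𝓘(ℝ, E) x →L[ℝ] TangentSpace 𝓘(ℝ, E) x) x (P x))

/-- The `(1,1)`-tensor field `P` is skew-symmetric with respect to `g`. -/
def SkewEnd (P : Π x : M, TangentSpace 𝓘(ℝ, E) x →L[ℝ] TangentSpace 𝓘(ℝ, E) x) : Prop :=
  ∀ (x : M) (v w : TangentSpace 𝓘(ℝ, E) x), g.inner x (P x v) w = -g.inner x v (P x w)

/-- The `(1,1)`-tensor field `P` is parallel: `(∇_U P) V = ∇_U (P V) - P (∇_U V)` vanishes. -/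
def ParallelEnd (P : Π x : M, TangentSpace 𝓘(ℝ, E) x →L[ℝ] TangentSpace 𝓘(ℝ, E) x) : Prop :=
  ∀ (x : M) (U V : Π x : M, TangentSpace 𝓘(ℝ, E) x), SmoothAt 𝓘(ℝ, E) U x →
    SmoothAt 𝓘(ℝ, E) V x → nabla g U (fun y => P y (V y)) x - P x (nabla g U V x) = 0

/-! ### The tangent bundle -/

variable (E M) in
/-- The tangent bundle `TM`, a manifold modelled on `E × E`. -/
abbrev TM : Type _ := TangentBundle 𝓘(ℝ, E) M

/-- The model with corners of `TM`. -/
abbrev IT (E : Type*) [NormedAddCommGroup E] [NormedSpace ℝ E] :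
    ModelWithCorners ℝ (E × E) (ModelProd E E) := 𝓘(ℝ, E).tangent

/-!
A tangent vector of `TM` at `p = (x, u)` is a pair `(v, w)`, standing for `v^i ∂/∂x^i + w^i ∂/∂u^i`
in the coordinates `(x^i, u^i)` that the preferred chart at `x` induces on `TM`. This chart of `TM`
is Mathlib's preferred chart at `p`.
-/

/-- The horizontal lift of `X` to `p = (x, u)`: `X^i ∂/∂x^i - Γ^i_{jk} u^j X^k ∂/∂u^i`. -/
def hLift (p : TM E M) (X : TangentSpace 𝓘(ℝ, E) p.1) : TangentSpace (IT E) p :=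
  ((X, -christoffel g p.1 p.2 X) : E × E)

/-- The vertical lift of `X` to `p = (x, u)`: `X^i ∂/∂u^i`. -/
def vLift (p : TM E M) (X : TangentSpace 𝓘(ℝ, E) p.1) : TangentSpace (IT E) p :=
  ((0, X) : E × E)

/-- The differential of the projection `TM → M`. -/
def dproj (p : TM E M) (w : TangentSpace (IT E) p) : TangentSpace 𝓘(ℝ, E) p.1 :=
  Prod.fst (α := E) (β := E) w

/-- The connection map `K : TTM → TM`. -/
def conn (p : TM E M) (w : TangentSpace (IT E) p) : TangentSpace 𝓘(ℝ, E) p.1 :=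
  Prod.snd (α := E) (β := E) w + christoffel g p.1 p.2 (Prod.fst (α := E) (β := E) w)

theorem dproj_hLift (p : TM E M) (X : TangentSpace 𝓘(ℝ, E) p.1) :
    dproj p (hLift g p X) = X := rfl

theorem dproj_vLift (p : TM E M) (X : TangentSpace 𝓘(ℝ, E) p.1) :
    dproj p (vLift p X) = 0 := rfl

theorem conn_hLift (p : TM E M) (X : TangentSpace 𝓘(ℝ, E) p.1) :
    conn g p (hLift g p X) = 0 :=
  neg_add_cancel (christoffel g p.1 p.2 X)

theorem conn_vLift (p : TM E M) (X : TangentSpace 𝓘(ℝ, E) p.1) :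
    conn g p (vLift p X) = X := by
  have h : christoffel g p.1 p.2 (0 : E) = 0 := map_zero _
  exact (congrArg (fun e : E => @HAdd.hAdd E E E _ X e) h).trans (add_zero (M := E) X)

/-- The Sasaki metric: `g^s(X^h, Y^h) = g^s(X^v, Y^v) = g(X, Y)`, `g^s(X^h, Y^v) = 0`. -/
def sasaki (p : TM E M) (w w' : TangentSpace (IT E) p) : ℝ :=
  g.inner p.1 (dproj p w) (dproj p w') + g.inner p.1 (conn g p w) (conn g p w')

/-- The horizontal lift of the metric: `g^h(X^h, Y^v) = g^h(X^v, Y^h) = g(X, Y)`,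
`g^h(X^h, Y^h) = g^h(X^v, Y^v) = 0`. -/
def horMetric (p : TM E M) (w w' : TangentSpace (IT E) p) : ℝ :=
  g.inner p.1 (dproj p w) (conn g p w') + g.inner p.1 (conn g p w) (dproj p w')

/-- The vertical lift of the metric: `g^v(X^h, Y^h) = g(X, Y)`,
`g^v(X^h, Y^v) = g^v(X^v, Y^h) = g^v(X^v, Y^v) = 0`. -/
def verMetric (p : TM E M) (w w' : TangentSpace (IT E) p) : ℝ :=
  g.inner p.1 (dproj p w) (dproj p w')

/-- `G = a g^s + b g^h + c g^v`. -/
def metricG (a b c : ℝ) (p : TM E M) (w w' : TangentSpace (IT E) p) : ℝ :=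
  a * sasaki g p w w' + b * horMetric g p w w' + c * verMetric g p w w'

/-- The horizontal lift of a vector field. -/
def hLiftField (X : Π x : M, TangentSpace 𝓘(ℝ, E) x) (p : TM E M) : TangentSpace (IT E) p :=
  hLift g p (X p.1)

/-- The vertical lift of a vector field. -/
def vLiftField (X : Π x : M, TangentSpace 𝓘(ℝ, E) x) (p : TM E M) : TangentSpace (IT E) p :=
  vLift p (X p.1)

/-- `(*P)_{(x,u)} = [P(u)]^h`. -/
def starLift (P : Π x : M, TangentSpace 𝓘(ℝ, E) x →L[ℝ] TangentSpace 𝓘(ℝ, E) x) (p : TM E M) :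
    TangentSpace (IT E) p :=
  hLift g p (P p.1 p.2)

/-- `(ι P)_{(x,u)} = [P(u)]^v`. -/
def iotaLift (P : Π x : M, TangentSpace 𝓘(ℝ, E) x →L[ℝ] TangentSpace 𝓘(ℝ, E) x) (p : TM E M) :
    TangentSpace (IT E) p :=
  vLift p (P p.1 p.2)

variable (M) in
/-- The identity `(1,1)`-tensor field. -/
def idEnd (E : Type*) [NormedAddCommGroup E] [NormedSpace ℝ E] [ChartedSpace E M] (x : M) :
    TangentSpace 𝓘(ℝ, E) x →L[ℝ] TangentSpace 𝓘(ℝ, E) x :=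
  ContinuousLinearMap.id ℝ _

/-- The vector field on `TM` built from `μ`, `ζ`, `P` and `ξ`; here `α = a (a + c) - b²`. -/
def homField (a b c μ : ℝ) (ζ : Π x : M, TangentSpace 𝓘(ℝ, E) x)
    (P : Π x : M, TangentSpace 𝓘(ℝ, E) x →L[ℝ] TangentSpace 𝓘(ℝ, E) x)
    (ξ : Π x : M, TangentSpace 𝓘(ℝ, E) x) (p : TM E M) : TangentSpace (IT E) p :=
  (a * (a + c) - b ^ 2)⁻¹ •
    (hLiftField g (a • ζ - b • ξ) p
      + starLift g (a • tensorC g ξ - b • P + (μ * a * b) • idEnd M E) p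
      + vLiftField ((a + c) • ξ - b • ζ) p
      + iotaLift ((a + c) • P - b • tensorC g ξ + (μ * ((a * (a + c) - b ^ 2) - b ^ 2)) • idEnd M E) p)

/-- `Z` arises from the factor `μ` and data `ζ`, `P`, `ξ` as in the classification. -/
def HasHomForm (a b c μ : ℝ) (Z : Π p : TM E M, TangentSpace (IT E) p) : Prop :=
  ∃ (ζ : Π x : M, TangentSpace 𝓘(ℝ, E) x)
    (P : Π x : M, TangentSpace 𝓘(ℝ, E) x →L[ℝ] TangentSpace 𝓘(ℝ, E) x)
    (ξ : Π x : M, TangentSpace 𝓘(ℝ, E) x),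
    (Smooth 𝓘(ℝ, E) ζ ∧ HomotheticWith 𝓘(ℝ, E) (metricTensor g) (μ * (a + c)) ζ) ∧
    (SmoothEnd P ∧ SkewEnd g P ∧ ParallelEnd g P) ∧
    (Smooth 𝓘(ℝ, E) ξ ∧ SkewNabla2 g ξ) ∧
    Z = homField g a b c μ ζ P ξ

end Base

end FlatTangent

end

/-!
Let `ζ̂` and `ξ̂` (`zetaT` and `xiT`) be the vector fields along the projection `TM → M` given by
`G(Z, Xʰ) = g(ζ̂, X)` and `G(Z, Xᵛ) = g(ξ̂, X)`. Since `a (a + c) - b² ≠ 0`, the pair `(ζ̂, ξ̂)`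
determines `Z`.

Because `g` is flat, the connection on `TM` for which the lifts of parallel fields are parallel is
torsion-free, flat, and makes `G` parallel for all `a`, `b`, `c`. Hence `𝓛_Z G = 2 μ G` is the
equation saying that the symmetric part of the covariant derivative of `(ζ̂, ξ̂)` is `μ G`
(`homotheticWith_metricG_iff`). As on any flat manifold, differentiating it once more gives a
trilinear form which is symmetric in its first two arguments, by flatness, and skew in the last two;
such a form is zero (`hess_eq_zero`). So all second covariant derivatives of `ζ̂` and `ξ̂` vanish.

* The second vertical derivatives vanish, so `ζ̂` and `ξ̂` are affine on the fibres
  (`eq_affine_of_hess_vertical`): `ζ̂ (x, u) = ζ + A u` and `ξ̂ (x, u) = ξ + B u`.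
* The mixed second derivatives vanish, so `A` and `B` are parallel (`hess_mixed`); the horizontal
  ones vanish, so `∇²ξ = 0` (`hess_horizontal`).
* The equation itself then says that `𝓛_ζ g = 2 μ (a + c) g`, that `A = C(ξ) + 2 μ b I`, and that
  `B - μ a I` is skew-symmetric (`HomEq.horizontal`, `HomEq.mixed`, `HomEq.vertical`). With
  `P = B - μ a I`, solving for `Z` gives the form in the classification (`eq_homField_iff`).

Conversely, `∇²ξ` is symmetric on a flat manifold, so it vanishes when it is also skew-symmetric.
Then `C(ξ)`, which is minus the adjoint of `∇ξ`, is parallel (`parallel_of_adjoint`), the covariant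
derivative of `(ζ̂, ξ̂)` is explicit (`covD_affine`), and the equation can be read off.

The definitions go through the preferred chart at each point, which changes with the point. The
fixed chart at a point `x₀` is used for all computations; the Christoffel symbols of the two charts
are compared in `christoffel_frame`, and the components of `∇_v Y` in `cov_eq`.
-/

open scoped Manifold ContDiff Topology Bundle
open Filter

noncomputable section

namespace FlatTangent

set_option linter.unusedSectionVars false
set_option maxSynthPendingDepth 3
set_option synthInstance.maxHeartbeats 200000

/-! ### Flat connections on a vector space, and the Killing argument -/

section Calculus

variable {E : Type*} [NormedAddCommGroup E] [NormedSpace ℝ E]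
  {Γ : E → E →L[ℝ] E →L[ℝ] E} {f ζ ξ : E × E → E}

/-- The covariant derivative at `y`, in the direction `v`, of the vector field `X` on the vector
space `E`, for the connection with Christoffel symbols `Γ`. -/
def covB (Γ : E → E →L[ℝ] E →L[ℝ] E) (X : E → E) (y v : E) : E :=
  fderiv ℝ X y v + Γ y v (X y)

/-- The covariant derivative at `p = (y, u)` of a vector field `f` along the projection `E × E → E`
(so `f (y, u)` is a tangent vector at `y`). The direction `V = (v, w)` stands for the sum of the
horizontal lift of `v` and the vertical lift of `w`, not for a vector of `E × E`. -/
def covD (Γ : E → E →L[ℝ] E →L[ℝ] E) (f : E × E → E) (p V : E × E) : E :=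
  fderiv ℝ f p (V.1, V.2 - Γ p.1 p.2 V.1) + Γ p.1 V.1 (f p)

/-- The second covariant derivative of a vector field on `E`. -/
def hessB (Γ : E → E →L[ℝ] E →L[ℝ] E) (X : E → E) (y u v : E) : E :=
  covB Γ (fun y => covB Γ X y v) y u - covB Γ X y (Γ y u v)

/-- The second covariant derivative of a vector field along the projection `E × E → E`, for the
connection on `E × E` that makes horizontal and vertical lifts of parallel fields parallel. -/
def hess (Γ : E → E →L[ℝ] E →L[ℝ] E) (f : E × E → E) (p V W : E × E) : E :=
  covD Γ (fun q => covD Γ f q W) p V - covD Γ f p (Γ p.1 V.1 W.1, Γ p.1 V.1 W.2)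

/-- The curvature of `Γ` vanishes at `y`. -/
def FlatAt (Γ : E → E →L[ℝ] E →L[ℝ] E) (y : E) : Prop :=
  ∀ u v w, fderiv ℝ Γ y u v w - fderiv ℝ Γ y v u w + Γ y u (Γ y v w) - Γ y v (Γ y u w) = 0

/-- The restriction to the zero section of the vertical derivative of `f`. -/
def vert (f : E × E → E) (y : E) : E →L[ℝ] E :=
  (fderiv ℝ f (y, 0)).comp (ContinuousLinearMap.inr ℝ E E)

theorem vert_apply (f : E × E → E) (y w : E) : vert f y w = fderiv ℝ f (y, 0) (0, w) := rfl

theorem covB_congr {X Y : E → E} {y : E} (h : X =ᶠ[𝓝 y] Y) (v : E) :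
    covB Γ X y v = covB Γ Y y v := by
  rw [covB, covB, h.fderiv_eq, h.self_of_nhds]

theorem hessB_congr {X Y : E → E} {y : E} (h : X =ᶠ[𝓝 y] Y) (u v : E) :
    hessB Γ X y u v = hessB Γ Y y u v := by
  rw [hessB, hessB, covB_congr h, covB_congr (h.eventuallyEq_nhds.mono fun z hz => covB_congr hz v)]

/-- Symmetry of the Christoffel symbols passes to their derivative. -/
theorem fderiv_christoffel_symm {y : E} (hΓ : DifferentiableAt ℝ Γ y)
    (hs : ∀ᶠ z in 𝓝 y, ∀ u v, Γ z u v = Γ z v u) (w u v : E) :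
    fderiv ℝ Γ y w u v = fderiv ℝ Γ y w v u := by
  have h1 : HasFDerivAt (fun z => Γ z u v) ((fderiv ℝ Γ y).flip u |>.flip v) y := by
    have := (hΓ.hasFDerivAt.clm_apply (hasFDerivAt_const u y)).clm_apply (hasFDerivAt_const v y)
    convert! this using 1
    ext; simp
  have h2 : HasFDerivAt (fun z => Γ z v u) ((fderiv ℝ Γ y).flip v |>.flip u) y := by
    have := (hΓ.hasFDerivAt.clm_apply (hasFDerivAt_const v y)).clm_apply (hasFDerivAt_const u y)
    convert! this using 1
    ext; simp
  have h3 := h1.unique (h2.congr_of_eventuallyEq (hs.mono fun z hz => hz u v))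
  simpa using DFunLike.congr_fun h3 w

theorem hasFDerivAt_covD {p : E × E} (hf : ContDiffAt ℝ 2 f p) (hΓ : DifferentiableAt ℝ Γ p.1)
    (W : E × E) : ∃ L : E × E →L[ℝ] E, HasFDerivAt (fun q => covD Γ f q W) L p ∧ ∀ X, L X =
      fderiv ℝ (fderiv ℝ f) p X (W.1, W.2 - Γ p.1 p.2 W.1)
      - fderiv ℝ f p (0, fderiv ℝ Γ p.1 X.1 p.2 W.1 + Γ p.1 X.2 W.1)
      + (fderiv ℝ Γ p.1 X.1 W.1 (f p) + Γ p.1 W.1 (fderiv ℝ f p X)) := by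
  have hf1 : HasFDerivAt f (fderiv ℝ f p) p := (hf.differentiableAt (by norm_num)).hasFDerivAt
  have hf2 : HasFDerivAt (fderiv ℝ f) (fderiv ℝ (fderiv ℝ f) p) p :=
    ((hf.fderiv_right (m := 1) (by norm_num)).differentiableAt (by norm_num)).hasFDerivAt
  have hG : HasFDerivAt (fun q : E × E => Γ q.1) _ p := hΓ.hasFDerivAt.comp p hasFDerivAt_fst
  have h1 := (hG.clm_apply hasFDerivAt_snd).clm_apply (hasFDerivAt_const W.1 p)
  have h2 := (hasFDerivAt_const W.1 p).prodMk ((hasFDerivAt_const W.2 p).sub h1)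
  have h3 := (hG.clm_apply (hasFDerivAt_const W.1 p)).clm_apply hf1
  refine ⟨_, (hf2.clm_apply h2).add h3, fun X => ?_⟩
  have : ((0 : E), -(fderiv ℝ Γ p.1 X.1 p.2 W.1 + Γ p.1 X.2 W.1))
    = -(0, fderiv ℝ Γ p.1 X.1 p.2 W.1 + Γ p.1 X.2 W.1) := by simp
  simp [ContinuousLinearMap.prod_apply]
  rw [← neg_add, this, map_neg]
  abel

/-- The Ricci identity for a flat connection: second covariant derivatives commute. -/
theorem hess_symm {p : E × E} (hf : ContDiffAt ℝ 2 f p) (hΓ : DifferentiableAt ℝ Γ p.1)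
    (hs : ∀ᶠ z in 𝓝 p.1, ∀ u v, Γ z u v = Γ z v u) (hR : FlatAt Γ p.1) (V W : E × E) :
    hess Γ f p V W = hess Γ f p W V := by
  obtain ⟨L, hL, hL'⟩ := hasFDerivAt_covD hf hΓ W
  obtain ⟨K, hK, hK'⟩ := hasFDerivAt_covD hf hΓ V
  have hsymm := (hf.isSymmSndFDerivAt (by simp)).eq
    (V.1, V.2 - Γ p.1 p.2 V.1) (W.1, W.2 - Γ p.1 p.2 W.1)
  have h1 : covD Γ (fun q => covD Γ f q W) p V = L (V.1, V.2 - Γ p.1 p.2 V.1)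
      + Γ p.1 V.1 (covD Γ f p W) := by rw [covD, hL.fderiv]
  have h2 : covD Γ (fun q => covD Γ f q V) p W = K (W.1, W.2 - Γ p.1 p.2 W.1)
      + Γ p.1 W.1 (covD Γ f p V) := by rw [covD, hK.fderiv]
  have hsp : ∀ u v, Γ p.1 u v = Γ p.1 v u := hs.self_of_nhds
  have hcurv := hR V.1 W.1 (f p)
  have hcurv' := hR V.1 W.1 p.2
  -- the first-order terms on both sides agree, since `[X^h, Y^h]` and `[X^h, Y^v]` are the
  -- expected ones in the absence of curvature
  have key : ((0 : E), fderiv ℝ Γ p.1 V.1 p.2 W.1 + Γ p.1 (V.2 - Γ p.1 p.2 V.1) W.1)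
      + (Γ p.1 V.1 W.1, Γ p.1 V.1 W.2 - Γ p.1 p.2 (Γ p.1 V.1 W.1))
      = (0, fderiv ℝ Γ p.1 W.1 p.2 V.1 + Γ p.1 (W.2 - Γ p.1 p.2 W.1) V.1)
      + (Γ p.1 W.1 V.1, Γ p.1 W.1 V.2 - Γ p.1 p.2 (Γ p.1 W.1 V.1)) := by
    ext
    · simp [hsp V.1 W.1]
    · rw [fderiv_christoffel_symm hΓ hs V.1 p.2 W.1, fderiv_christoffel_symm hΓ hs W.1 p.2 V.1]
      simp only [Prod.snd_add, map_sub, sub_apply]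
      rw [hsp V.1 W.1, hsp V.2 W.1, hsp W.2 V.1, hsp (Γ p.1 p.2 V.1) W.1,
        hsp (Γ p.1 p.2 W.1) V.1, hsp p.2 V.1, hsp p.2 W.1]
      rw [← sub_eq_zero, ← neg_eq_zero]
      rw [← neg_eq_zero] at hcurv'
      rw [← hcurv']
      abel
  have key' := congrArg (fderiv ℝ f p) key
  simp only [map_add] at key'
  rw [hess, hess, h1, h2, hL', hK']
  simp only [covD, map_add, hsymm]
  rw [← sub_eq_zero] at key' ⊢
  rw [hsp W.1 V.1] at key' ⊢
  have : ∀ x y z : E, x = y - z → y = 0 → z = 0 → x = 0 := by rintro _ _ _ rfl rfl rfl; simp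
  refine this _ _ _ ?_ hcurv key'
  abel

/-- `G` is parallel for `Γ` at `y`. -/
def CompatAt (Γ : E → E →L[ℝ] E →L[ℝ] E) (G : E → E →L[ℝ] E →L[ℝ] ℝ) (y : E) : Prop :=
  ∀ u v w, fderiv ℝ G y u v w = G y (Γ y u v) w + G y v (Γ y u w)

theorem covD_const (e : E) (p V : E × E) : covD Γ (fun _ => e) p V = Γ p.1 V.1 e := by
  simp [covD]

theorem hasFDerivAt_metric_apply {G : E → E →L[ℝ] E →L[ℝ] ℝ} {h : E × E → E} {p : E × E}
    (hG : DifferentiableAt ℝ G p.1) (hc : CompatAt Γ G p.1) (hh : DifferentiableAt ℝ h p) (w : E) :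
    ∃ L : E × E →L[ℝ] ℝ, HasFDerivAt (fun q => G q.1 (h q) w) L p ∧ ∀ U : E × E,
      L (U.1, U.2 - Γ p.1 p.2 U.1) = G p.1 (covD Γ h p U) w + G p.1 (h p) (Γ p.1 U.1 w) := by
  have h0 : HasFDerivAt (fun q : E × E => G q.1) _ p := hG.hasFDerivAt.comp p hasFDerivAt_fst
  refine ⟨_, (h0.clm_apply hh.hasFDerivAt).clm_apply (hasFDerivAt_const w p), fun U => ?_⟩
  have := hc U.1 (h p) w
  simp [covD, this]
  ring

/-- The Killing argument. The right-hand side of `hK` is parallel, so differentiating `hK` shows that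
the trilinear form `(U, V, W) ↦ G(∇²ζ(U, V), W.1) + G(∇²ξ(U, V), W.2)` is skew in `V` and `W`. It is
symmetric in `U` and `V` by flatness, so it vanishes. -/
theorem hess_eq_zero {G : E → E →L[ℝ] E →L[ℝ] ℝ} {p : E × E} {A B C : ℝ}
    (hζ : ContDiffAt ℝ 2 ζ p) (hξ : ContDiffAt ℝ 2 ξ p) (hΓ : DifferentiableAt ℝ Γ p.1)
    (hs : ∀ᶠ z in 𝓝 p.1, ∀ u v, Γ z u v = Γ z v u) (hR : FlatAt Γ p.1)
    (hG : DifferentiableAt ℝ G p.1) (hc : CompatAt Γ G p.1)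
    (hnd : ∀ v, (∀ w, G p.1 v w = 0) → v = 0)
    (hK : ∀ᶠ q in 𝓝 p, ∀ V W : E × E,
      G q.1 (covD Γ ζ q V) W.1 + G q.1 (covD Γ ξ q V) W.2
        + (G q.1 (covD Γ ζ q W) V.1 + G q.1 (covD Γ ξ q W) V.2)
      = A * G q.1 V.1 W.1 + B * (G q.1 V.1 W.2 + G q.1 V.2 W.1) + C * G q.1 V.2 W.2)
    (U V : E × E) : hess Γ ζ p U V = 0 ∧ hess Γ ξ p U V = 0 := by
  have dζ : ∀ V, DifferentiableAt ℝ (fun q => covD Γ ζ q V) p := fun V => by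
    obtain ⟨L, hL, -⟩ := hasFDerivAt_covD hζ hΓ V
    exact hL.differentiableAt
  have dξ : ∀ V, DifferentiableAt ℝ (fun q => covD Γ ξ q V) p := fun V => by
    obtain ⟨L, hL, -⟩ := hasFDerivAt_covD hξ hΓ V
    exact hL.differentiableAt
  have skew : ∀ U V W : E × E, G p.1 (hess Γ ζ p U V) W.1 + G p.1 (hess Γ ξ p U V) W.2
      = -(G p.1 (hess Γ ζ p U W) V.1 + G p.1 (hess Γ ξ p U W) V.2) := by
    intro U V W
    obtain ⟨L1, h1, h1'⟩ := hasFDerivAt_metric_apply hG hc (dζ V) W.1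
    obtain ⟨L2, h2, h2'⟩ := hasFDerivAt_metric_apply hG hc (dξ V) W.2
    obtain ⟨L3, h3, h3'⟩ := hasFDerivAt_metric_apply hG hc (dζ W) V.1
    obtain ⟨L4, h4, h4'⟩ := hasFDerivAt_metric_apply hG hc (dξ W) V.2
    obtain ⟨L5, h5, h5'⟩ := hasFDerivAt_metric_apply hG hc (differentiableAt_const V.1) W.1
    obtain ⟨L6, h6, h6'⟩ := hasFDerivAt_metric_apply hG hc (differentiableAt_const V.1) W.2
    obtain ⟨L7, h7, h7'⟩ := hasFDerivAt_metric_apply hG hc (differentiableAt_const V.2) W.1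
    obtain ⟨L8, h8, h8'⟩ := hasFDerivAt_metric_apply hG hc (differentiableAt_const V.2) W.2
    have e := ((h1.fun_add h2).fun_add (h3.fun_add h4)).unique
      ((((h5.const_mul A).fun_add ((h6.fun_add h7).const_mul B)).fun_add
        (h8.const_mul C)).congr_of_eventuallyEq (hK.mono fun q hq => hq V W))
    have e' := DFunLike.congr_fun e (U.1, U.2 - Γ p.1 p.2 U.1)
    simp only [add_apply, smul_apply, smul_eq_mul, h1', h2', h3', h4', h5', h6', h7', h8',
      covD_const] at e'
    have k1 := hK.self_of_nhds (Γ p.1 U.1 V.1, Γ p.1 U.1 V.2) W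
    have k2 := hK.self_of_nhds V (Γ p.1 U.1 W.1, Γ p.1 U.1 W.2)
    simp only [hess, map_sub, sub_apply]
    linarith
  have zero : ∀ W : E × E, G p.1 (hess Γ ζ p U V) W.1 + G p.1 (hess Γ ξ p U V) W.2 = 0 := by
    intro W
    have sζ := fun V W => hess_symm hζ hΓ hs hR V W
    have sξ := fun V W => hess_symm hξ hΓ hs hR V W
    have a1 := skew U V W
    have a2 := skew V W U
    have a3 := skew W U V
    rw [sζ V W, sξ V W, sζ V U, sξ V U] at a2
    rw [sζ W U, sξ W U] at a3
    linarith
  exact ⟨hnd _ fun w => by simpa using zero (w, 0), hnd _ fun w => by simpa using zero (0, w)⟩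

/-! ### Vector fields along the projection that are affine on the fibres -/

theorem covD_horizontal {y : E} (hf : DifferentiableAt ℝ f (y, 0)) (v : E) :
    covD Γ f (y, 0) (v, 0) = covB Γ (fun z => f (z, 0)) y v := by
  have h : HasFDerivAt (fun z : E => (z, (0 : E))) (ContinuousLinearMap.inl ℝ E E) y :=
    (hasFDerivAt_id y).prodMk (hasFDerivAt_const 0 y)
  have h' := (hf.hasFDerivAt.comp y h).fderiv
  simp only [Function.comp_def] at h'
  simp [covD, covB, h']

theorem covD_vertical (y u w : E) : covD Γ f (y, u) (0, w) = fderiv ℝ f (y, u) (0, w) := by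
  simp [covD]

theorem hess_horizontal {y : E} (hf : ContDiffAt ℝ 2 f (y, 0)) (hΓ : DifferentiableAt ℝ Γ y)
    (u v : E) : hess Γ f (y, 0) (u, 0) (v, 0) = hessB Γ (fun z => f (z, 0)) y u v := by
  obtain ⟨L, hL, -⟩ := hasFDerivAt_covD (Γ := Γ) (p := (y, 0)) hf hΓ (v, 0)
  have hd : ∀ᶠ q in 𝓝 (y, (0 : E)), DifferentiableAt ℝ f q :=
    (hf.eventually (by simp)).mono fun q hq => hq.differentiableAt (by norm_num)
  have hd' : ∀ᶠ z in 𝓝 y, DifferentiableAt ℝ f (z, 0) :=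
    (Continuous.prodMk_left (0 : E)).continuousAt.eventually hd
  have hev : (fun z => covD Γ f (z, 0) (v, 0)) =ᶠ[𝓝 y] fun z => covB Γ (fun z => f (z, 0)) z v :=
    hd'.mono fun z hz => covD_horizontal hz v
  simp only [hess, hessB, map_zero]
  rw [covD_horizontal hL.differentiableAt, covD_horizontal hd.self_of_nhds, covB, covB,
    hev.fderiv_eq, covD_horizontal hd.self_of_nhds]
  rfl

theorem hess_mixed {y : E} (hf : ContDiffAt ℝ 2 f (y, 0)) (hΓ : DifferentiableAt ℝ Γ y)
    (v w : E) : hess Γ f (y, 0) (v, 0) (0, w)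
      = covB Γ (fun z => vert f z w) y v - vert f y (Γ y v w) := by
  obtain ⟨L, hL, -⟩ := hasFDerivAt_covD (Γ := Γ) (p := (y, 0)) hf hΓ (0, w)
  simp only [hess, map_zero]
  rw [covD_horizontal hL.differentiableAt, covD_vertical]
  simp only [covD_vertical, vert_apply]

theorem hess_vertical {y u : E} (hf : ContDiffAt ℝ 2 f (y, u)) (v w : E) :
    hess Γ f (y, u) (0, v) (0, w) = fderiv ℝ (fderiv ℝ f) (y, u) (0, v) (0, w) := by
  have hf2 : HasFDerivAt (fderiv ℝ f) (fderiv ℝ (fderiv ℝ f) (y, u)) (y, u) :=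
    ((hf.fderiv_right (m := 1) (by norm_num)).differentiableAt (by norm_num)).hasFDerivAt
  have h := (hf2.clm_apply (hasFDerivAt_const ((0 : E), w) (y, u))).fderiv
  have : ((0 : E), (0 : E)) = 0 := rfl
  simp [hess, h, this, covD]

/-- A field along the projection with vanishing second vertical derivatives is affine on fibres. -/
theorem eq_affine_of_hess_vertical {y : E} (hf : ∀ u, ContDiffAt ℝ 2 f (y, u))
    (h0 : ∀ u v w, hess Γ f (y, u) (0, v) (0, w) = 0) (u : E) :
    f (y, u) = f (y, 0) + vert f y u := by
  have hi : ∀ u, HasFDerivAt (fun u : E => (y, u)) (ContinuousLinearMap.inr ℝ E E) u := fun u =>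
    (hasFDerivAt_const y u).prodMk (hasFDerivAt_id u)
  have h1 : ∀ u w, fderiv ℝ f (y, u) (0, w) = vert f y w := by
    intro u w
    have hd : ∀ u, HasFDerivAt (fun u : E => fderiv ℝ f (y, u) (0, w)) (0 : E →L[ℝ] E) u := by
      intro u
      have hf2 : HasFDerivAt (fderiv ℝ f) (fderiv ℝ (fderiv ℝ f) (y, u)) (y, u) :=
        (((hf u).fderiv_right (m := 1) (by norm_num)).differentiableAt (by norm_num)).hasFDerivAt
      have := (hf2.comp u (hi u)).clm_apply (hasFDerivAt_const ((0 : E), w) u)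
      convert! this using 1
      ext v
      simpa using ((hess_vertical (Γ := Γ) (hf u) v w).symm.trans (h0 u v w)).symm
    exact is_const_of_fderiv_eq_zero (fun u => (hd u).differentiableAt) (fun u => (hd u).fderiv) u 0
  have hd : ∀ u, HasFDerivAt (fun u : E => f (y, u) - vert f y u) (0 : E →L[ℝ] E) u := by
    intro u
    have := ((((hf u).differentiableAt (by norm_num)).hasFDerivAt).comp u (hi u)).sub
      (vert f y).hasFDerivAt
    convert! this using 1
    ext v
    simp [h1]
  have := is_const_of_fderiv_eq_zero (fun u => (hd u).differentiableAt) (fun u => (hd u).fderiv) u 0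
  simp only [map_zero, sub_zero] at this
  rw [← this]; abel

/-- The covariant derivative of a field along the projection that is affine on fibres, with
parallel linear part. -/
theorem covD_affine {y u : E} {Q : E → E →L[ℝ] E} {X : E → E}
    (hf : ∀ᶠ z in 𝓝 y, ∀ u, f (z, u) = X z + Q z u)
    (hX : DifferentiableAt ℝ X y) (hQ : DifferentiableAt ℝ Q y)
    (hp : ∀ v w, covB Γ (fun z => Q z w) y v = Q y (Γ y v w))
    (hs : ∀ v w, Γ y v w = Γ y w v) (V : E × E) :
    covD Γ f (y, u) V = covB Γ X y V.1 + Q y V.2 := by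
  have hf' : f =ᶠ[𝓝 (y, u)] fun q => X q.1 + Q q.1 q.2 := by
    have := (continuous_fst (X := E) (Y := E)).continuousAt (x := (y, u)) |>.eventually hf
    exact this.mono fun q hq => hq q.2
  have h1 : HasFDerivAt (fun q : E × E => X q.1) _ (y, u) :=
    hX.hasFDerivAt.comp (y, u) hasFDerivAt_fst
  have h2 : HasFDerivAt (fun q : E × E => Q q.1) _ (y, u) :=
    hQ.hasFDerivAt.comp (y, u) hasFDerivAt_fst
  have h3 := h1.fun_add (h2.clm_apply hasFDerivAt_snd)
  have h4 := (hQ.hasFDerivAt.clm_apply (hasFDerivAt_const u y)).fderiv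
  have h5 := hp V.1 u
  simp only [covB, h4] at h5
  simp only [ContinuousLinearMap.comp_zero, zero_add, ContinuousLinearMap.flip_apply] at h5
  simp only [covD, covB, hf'.fderiv_eq, hf'.self_of_nhds, h3.fderiv]
  simp only [add_apply, ContinuousLinearMap.comp_apply, ContinuousLinearMap.coe_fst',
    ContinuousLinearMap.coe_snd', ContinuousLinearMap.flip_apply, map_add, map_sub]
  rw [hs u V.1, ← h5]
  abel

theorem contDiffAt_vert {y : E} (hf : ContDiffAt ℝ ∞ f (y, 0)) : ContDiffAt ℝ ∞ (vert f) y := by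
  have h1 : ContDiffAt ℝ ∞ (fun z : E => (z, (0 : E))) y := contDiffAt_id.prodMk contDiffAt_const
  have h2 : ContDiffAt ℝ ∞ (fun z : E => fderiv ℝ f (z, 0)) y :=
    ContDiffAt.comp (g := fderiv ℝ f) y (hf.fderiv_right (by simp)) h1
  exact h2.clm_comp contDiffAt_const

theorem hasFDerivAt_fibre {y : E} (hf : DifferentiableAt ℝ f (y, 0)) :
    HasFDerivAt (fun u => f (y, u)) (vert f y) 0 :=
  HasFDerivAt.comp (g := f) (0 : E) hf.hasFDerivAt
    ((hasFDerivAt_const y (0 : E)).prodMk (hasFDerivAt_id (0 : E)))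

theorem vert_eq_of_affine {y : E} (hf : DifferentiableAt ℝ f (y, 0)) {e : E} {Q : E →L[ℝ] E}
    (h : ∀ u, f (y, u) = e + Q u) : vert f y = Q := by
  have h1 := hasFDerivAt_fibre hf
  simp only [h] at h1
  exact h1.unique (Q.hasFDerivAt.const_add e)

theorem parallel_add_smul_id {y : E} {Q : E → E →L[ℝ] E} (r : ℝ)
    (h : ∀ v w, covB Γ (fun z => Q z w) y v = Q y (Γ y v w)) (v w : E) :
    covB Γ (fun z => (Q z + r • ContinuousLinearMap.id ℝ E) w) y v
      = (Q y + r • ContinuousLinearMap.id ℝ E) (Γ y v w) := by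
  have h1 := h v w
  simp only [covB, add_apply, smul_apply, ContinuousLinearMap.id_apply, fderiv_add_const,
    map_add, map_smul] at h1 ⊢
  rw [← add_assoc, h1]

end Calculus

/-! ### The Levi-Civita connection of a metric on a vector space -/

section Christoffel

variable {E : Type*} [NormedAddCommGroup E] [NormedSpace ℝ E]
  {G G₁ G₂ : E → E →L[ℝ] E →L[ℝ] ℝ} {y : E}

/-- The Christoffel symbols of the metric `G` on a vector space. -/
def chr (G : E → E →L[ℝ] E →L[ℝ] ℝ) (y : E) : E →L[ℝ] E →L[ℝ] E :=
  (ContinuousLinearMap.compL ℝ E (E →L[ℝ] ℝ) E (G y).inverse).comp (koszul (fderiv ℝ G y))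

theorem inner_chr (hi : (G y).IsInvertible) (u v w : E) :
    G y (chr G y u v) w =
      (1 / 2) * (fderiv ℝ G y u v w + fderiv ℝ G y v u w - fderiv ℝ G y w u v) := by
  obtain ⟨e, he⟩ := hi
  have : G y (chr G y u v) = koszul (fderiv ℝ G y) u v := by
    simp [chr, ← he]
  rw [this]
  rfl

theorem eq_of_inner_eq (hi : (G y).IsInvertible) {v v' : E} (h : ∀ w, G y v w = G y v' w) :
    v = v' := by
  obtain ⟨e, he⟩ := hi
  apply e.injective
  ext w
  have := h w
  rwa [← he] at this

theorem hasFDerivAt_metric_const (hG : DifferentiableAt ℝ G y) (u v : E) :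
    HasFDerivAt (fun z => G z u v) (((fderiv ℝ G y).flip u).flip v) y := by
  have := (hG.hasFDerivAt.clm_apply (hasFDerivAt_const u y)).clm_apply (hasFDerivAt_const v y)
  convert! this using 1
  ext; simp

theorem fderiv_metric_symm (hG : DifferentiableAt ℝ G y)
    (hs : ∀ᶠ z in 𝓝 y, ∀ u v, G z u v = G z v u) (w u v : E) :
    fderiv ℝ G y w u v = fderiv ℝ G y w v u := by
  have h3 := (hasFDerivAt_metric_const hG u v).unique
    ((hasFDerivAt_metric_const hG v u).congr_of_eventuallyEq (hs.mono fun z hz => hz u v))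
  simpa using DFunLike.congr_fun h3 w

theorem chr_symm (hG : DifferentiableAt ℝ G y) (hi : (G y).IsInvertible)
    (hs : ∀ᶠ z in 𝓝 y, ∀ u v, G z u v = G z v u) (u v : E) : chr G y u v = chr G y v u := by
  refine eq_of_inner_eq hi fun w => ?_
  rw [inner_chr hi, inner_chr hi, fderiv_metric_symm hG hs w u v]
  ring

theorem chr_compatAt (hG : DifferentiableAt ℝ G y) (hi : (G y).IsInvertible)
    (hs : ∀ᶠ z in 𝓝 y, ∀ u v, G z u v = G z v u) : CompatAt (chr G) G y := by
  intro u v w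
  rw [hs.self_of_nhds v, inner_chr hi, inner_chr hi, fderiv_metric_symm hG hs w u v,
    fderiv_metric_symm hG hs v u w, fderiv_metric_symm hG hs u w v]
  ring

theorem contDiffAt_chr [CompleteSpace E] (hG : ContDiffAt ℝ ∞ G y) (hi : (G y).IsInvertible) :
    ContDiffAt ℝ ∞ (chr G) y := by
  obtain ⟨e, he⟩ := hi
  have h1 : ContDiffAt ℝ ∞ (fun z => (G z).inverse) y := by
    have := contDiffAt_map_inverse (n := ∞) e
    rw [he] at this
    exact this.comp y hG
  have h2 : ContDiffAt ℝ ∞ (fderiv ℝ G) y := hG.fderiv_right (by simp)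
  have h3 : ContDiffAt ℝ ∞ (fun z => koszul (fderiv ℝ G z)) y := by
    have hf := (ContinuousLinearMap.flipₗᵢ ℝ E E (E →L[ℝ] ℝ)).toContinuousLinearEquiv.contDiff
      (n := ∞) |>.contDiffAt.comp y h2
    exact (contDiffAt_const (c := (1 / 2 : ℝ))).smul ((h2.add hf).sub (contDiffAt_const.clm_comp hf))
  exact ((ContinuousLinearMap.compL ℝ E (E →L[ℝ] ℝ) E).contDiff.contDiffAt.comp y h1).clm_comp h3

/-- The transformation law of the Christoffel symbols under a change of coordinates `φ`. -/
theorem chr_transform {φ : E → E} (hφ : ContDiffAt ℝ 2 φ y) (hb : (fderiv ℝ φ y).IsInvertible)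
    (hG₂ : DifferentiableAt ℝ G₂ (φ y)) (hi₁ : (G₁ y).IsInvertible)
    (hi₂ : (G₂ (φ y)).IsInvertible) (hs : ∀ u v, G₂ (φ y) u v = G₂ (φ y) v u)
    (hG₁ : DifferentiableAt ℝ G₁ y)
    (hG : ∀ᶠ z in 𝓝 y, ∀ u v, G₁ z u v = G₂ (φ z) (fderiv ℝ φ z u) (fderiv ℝ φ z v)) (u v : E) :
    fderiv ℝ φ y (chr G₁ y u v) = chr G₂ (φ y) (fderiv ℝ φ y u) (fderiv ℝ φ y v)
      + fderiv ℝ (fderiv ℝ φ) y u v := by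
  have hφ1 : HasFDerivAt φ (fderiv ℝ φ y) y := (hφ.differentiableAt (by norm_num)).hasFDerivAt
  have hφ2 : HasFDerivAt (fderiv ℝ φ) (fderiv ℝ (fderiv ℝ φ) y) y :=
    ((hφ.fderiv_right (m := 1) (by norm_num)).differentiableAt (by norm_num)).hasFDerivAt
  have hsymm := (hφ.isSymmSndFDerivAt (by simp)).eq
  have hD : ∀ w u v, fderiv ℝ G₁ y w u v
      = fderiv ℝ G₂ (φ y) (fderiv ℝ φ y w) (fderiv ℝ φ y u) (fderiv ℝ φ y v)
        + G₂ (φ y) (fderiv ℝ (fderiv ℝ φ) y w u) (fderiv ℝ φ y v)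
        + G₂ (φ y) (fderiv ℝ φ y u) (fderiv ℝ (fderiv ℝ φ) y w v) := by
    intro w u v
    have h1 := ((hG₂.hasFDerivAt.comp y hφ1).clm_apply
      (hφ2.clm_apply (hasFDerivAt_const u y))).clm_apply (hφ2.clm_apply (hasFDerivAt_const v y))
    have h3 := (hasFDerivAt_metric_const hG₁ u v).unique
      (h1.congr_of_eventuallyEq (hG.mono fun z hz => hz u v))
    have := DFunLike.congr_fun h3 w
    simp at this
    rw [this]
    ring
  refine eq_of_inner_eq hi₂ fun w => ?_
  obtain ⟨w, rfl⟩ : ∃ w', fderiv ℝ φ y w' = w := by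
    obtain ⟨e, he⟩ := hb
    exact ⟨e.symm w, by rw [← he]; simp⟩
  rw [← hG.self_of_nhds, inner_chr hi₁, hD, hD, hD, map_add, add_apply, inner_chr hi₂,
    hsymm v u, hsymm w u, hsymm w v, hs (fderiv ℝ φ y v), hs (fderiv ℝ φ y u) (fderiv ℝ (fderiv ℝ φ) y v w)]
  ring

theorem covB_transform {φ X₁ X₂ : E → E} (hφ : ContDiffAt ℝ 2 φ y)
    (hX₂ : DifferentiableAt ℝ X₂ (φ y)) (hX₁ : DifferentiableAt ℝ X₁ y)
    (hX : ∀ᶠ z in 𝓝 y, X₂ (φ z) = fderiv ℝ φ z (X₁ z))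
    {Γ₁ Γ₂ : E → E →L[ℝ] E →L[ℝ] E}
    (hΓ : ∀ u v, fderiv ℝ φ y (Γ₁ y u v) = Γ₂ (φ y) (fderiv ℝ φ y u) (fderiv ℝ φ y v)
      + fderiv ℝ (fderiv ℝ φ) y u v) (v : E) :
    covB Γ₂ X₂ (φ y) (fderiv ℝ φ y v) = fderiv ℝ φ y (covB Γ₁ X₁ y v) := by
  have hφ1 : HasFDerivAt φ (fderiv ℝ φ y) y := (hφ.differentiableAt (by norm_num)).hasFDerivAt
  have hφ2 : HasFDerivAt (fderiv ℝ φ) (fderiv ℝ (fderiv ℝ φ) y) y :=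
    ((hφ.fderiv_right (m := 1) (by norm_num)).differentiableAt (by norm_num)).hasFDerivAt
  have h := DFunLike.congr_fun ((hX₂.hasFDerivAt.comp y hφ1).unique
    ((hφ2.clm_apply hX₁.hasFDerivAt).congr_of_eventuallyEq hX)) v
  simp only [add_apply, ContinuousLinearMap.comp_apply, ContinuousLinearMap.flip_apply] at h
  rw [covB, covB, map_add, hΓ, h, hX.self_of_nhds]
  abel

end Christoffel

/-! ### Lie brackets and Lie derivatives in coordinates -/

section LieLocal

variable {E : Type*} [NormedAddCommGroup E] [NormedSpace ℝ E]
  {Γ : E → E →L[ℝ] E →L[ℝ] E} {G : E → E →L[ℝ] E →L[ℝ] ℝ}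

theorem lieBracket_eq_covB {y : E} {Z V : E → E} (hs : ∀ u v, Γ y u v = Γ y v u) :
    VectorField.lieBracket ℝ Z V y = covB Γ V y (Z y) - covB Γ Z y (V y) := by
  rw [VectorField.lieBracket, covB, covB, hs (V y)]
  abel

theorem fderiv_metric_fields {y : E} {V W : E → E} (hG : DifferentiableAt ℝ G y)
    (hc : CompatAt Γ G y) (hV : DifferentiableAt ℝ V y) (hW : DifferentiableAt ℝ W y) :
    ∃ L : E →L[ℝ] ℝ, HasFDerivAt (fun z => G z (V z) (W z)) L y ∧
      ∀ u, L u = G y (covB Γ V y u) (W y) + G y (V y) (covB Γ W y u) := by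
  refine ⟨_, (hG.hasFDerivAt.clm_apply hV.hasFDerivAt).clm_apply hW.hasFDerivAt, fun u => ?_⟩
  have := hc u (V y) (W y)
  simp [covB, this]
  ring

/-- If `Q` is minus the adjoint of `∇X`, and `∇²X = 0`, then
`Q` is parallel. -/
theorem parallel_of_adjoint {y : E} {X : E → E} {Q : E → E →L[ℝ] E}
    (hG : DifferentiableAt ℝ G y) (hc : CompatAt Γ G y)
    (hnd : ∀ v, (∀ w, G y v w = 0) → v = 0) (hΓ : ContDiffAt ℝ 1 Γ y) (hX : ContDiffAt ℝ 2 X y)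
    (hQ : DifferentiableAt ℝ Q y)
    (heq : ∀ᶠ z in 𝓝 y, ∀ u w, G z (Q z u) w = -G z u (covB Γ X z w))
    (hess : ∀ v w, hessB Γ X y v w = 0) (v u : E) :
    covB Γ (fun z => Q z u) y v = Q y (Γ y v u) := by
  rw [← sub_eq_zero]
  refine hnd _ fun w => ?_
  have hconst : ∀ e : E, covB Γ (fun _ => e) y v = Γ y v e := fun e => by simp [covB]
  have dX : DifferentiableAt ℝ (fun z => covB Γ X z w) y := by
    have h := (((hX.fderiv_right (m := 1) (by norm_num)).clm_apply (contDiffAt_const (c := w))).add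
      ((hΓ.clm_apply (contDiffAt_const (c := w))).clm_apply (hX.of_le (by norm_num))))
    exact h.differentiableAt (by norm_num)
  obtain ⟨L1, h1, h1'⟩ := fderiv_metric_fields hG hc
    (hQ.clm_apply (differentiableAt_const u)) (differentiableAt_const w)
  obtain ⟨L2, h2, h2'⟩ := fderiv_metric_fields hG hc (differentiableAt_const u) dX
  -- the covariant derivative of `heq`, with `u` and `w` extended as constant fields
  have e := h1.unique (h2.fun_neg.congr_of_eventuallyEq
    (heq.mono fun z hz => hz u w))
  have e' := DFunLike.congr_fun e v
  simp only [neg_apply, h1', h2', hconst] at e'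
  have k1 := heq.self_of_nhds (Γ y v u) w
  have k2 := heq.self_of_nhds u (Γ y v w)
  have k3 : G y u (covB Γ (fun z => covB Γ X z w) y v) = G y u (covB Γ X y (Γ y v w)) := by
    have := hess v w
    rw [hessB, sub_eq_zero] at this
    rw [this]
  rw [map_sub, sub_apply]
  linarith

/-- The vertical part of the field `Z` on `E × E`, with respect to the connection `Γ`. -/
def vpart (Γ : E → E →L[ℝ] E →L[ℝ] E) (Z : E × E → E × E) (p : E × E) : E :=
  (Z p).2 + Γ p.1 p.2 (Z p).1

theorem covD_fst_vpart (f : E × E → E) (Z : E × E → E × E) (p : E × E) :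
    covD Γ f p ((Z p).1, vpart Γ Z p) = fderiv ℝ f p (Z p) + Γ p.1 (Z p).1 (f p) := by
  simp [covD, vpart]

theorem hasFDerivAt_vpart {Z : E × E → E × E} {p : E × E} (hZ : DifferentiableAt ℝ Z p)
    (hΓ : DifferentiableAt ℝ Γ p.1) : ∃ L : E × E →L[ℝ] E, HasFDerivAt (vpart Γ Z) L p ∧
      ∀ X, L X = (fderiv ℝ Z p X).2 + (fderiv ℝ Γ p.1 X.1 p.2 (Z p).1 + Γ p.1 X.2 (Z p).1
        + Γ p.1 p.2 (fderiv ℝ Z p X).1) := by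
  have hG : HasFDerivAt (fun q : E × E => Γ q.1) _ p := hΓ.hasFDerivAt.comp p hasFDerivAt_fst
  refine ⟨_, hZ.hasFDerivAt.snd.add ((hG.clm_apply hasFDerivAt_snd).clm_apply hZ.hasFDerivAt.fst),
    fun X => ?_⟩
  simp
  abel

theorem lieBracket_fst {Z V : E × E → E × E} {p : E × E} (hZ : DifferentiableAt ℝ Z p)
    (hV : DifferentiableAt ℝ V p) (hs : ∀ u v, Γ p.1 u v = Γ p.1 v u) :
    (VectorField.lieBracket ℝ Z V p).1 = covD Γ (fun q => (V q).1) p ((Z p).1, vpart Γ Z p)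
      - covD Γ (fun q => (Z q).1) p ((V p).1, vpart Γ V p) := by
  rw [covD_fst_vpart, covD_fst_vpart, hs (V p).1, hZ.hasFDerivAt.fst.fderiv,
    hV.hasFDerivAt.fst.fderiv]
  simp [VectorField.lieBracket]

/-- The vertical part of a Lie bracket; the curvature term that appears in general is absent. -/
theorem lieBracket_vpart {Z V : E × E → E × E} {p : E × E} (hZ : DifferentiableAt ℝ Z p)
    (hV : DifferentiableAt ℝ V p) (hΓ : DifferentiableAt ℝ Γ p.1)
    (hs : ∀ᶠ z in 𝓝 p.1, ∀ u v, Γ z u v = Γ z v u) (hR : FlatAt Γ p.1) :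
    (VectorField.lieBracket ℝ Z V p).2 + Γ p.1 p.2 (VectorField.lieBracket ℝ Z V p).1
      = covD Γ (vpart Γ V) p ((Z p).1, vpart Γ Z p)
      - covD Γ (vpart Γ Z) p ((V p).1, vpart Γ V p) := by
  obtain ⟨L, hL, hL'⟩ := hasFDerivAt_vpart hZ hΓ
  obtain ⟨K, hK, hK'⟩ := hasFDerivAt_vpart hV hΓ
  have hsp : ∀ u v, Γ p.1 u v = Γ p.1 v u := hs.self_of_nhds
  have hcurv := hR (Z p).1 (V p).1 p.2
  rw [covD_fst_vpart, covD_fst_vpart, hL.fderiv, hK.fderiv, hL', hK',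
    fderiv_christoffel_symm hΓ hs (Z p).1 p.2, fderiv_christoffel_symm hΓ hs (V p).1 p.2,
    vpart, vpart, map_add, map_add, hsp p.2 (V p).1, hsp p.2 (Z p).1,
    hsp (V p).2, hsp (Z p).2]
  simp only [VectorField.lieBracket, Prod.fst_sub, Prod.snd_sub, map_sub]
  rw [← sub_eq_zero, ← neg_eq_zero, ← hcurv]
  abel

/-- The metric `a g^s + b g^h + c g^v` in terms of horizontal and vertical parts. -/
def bigMetric (G : E → E →L[ℝ] E →L[ℝ] ℝ) (a b c : ℝ) (y : E) (V W : E × E) : ℝ :=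
  a * (G y V.1 W.1 + G y V.2 W.2) + b * (G y V.1 W.2 + G y V.2 W.1) + c * G y V.1 W.1

/-- The Lie derivative of `a g^s + b g^h + c g^v`. Here `lift V` is the pair of the horizontal and
vertical parts of `V`. By compatibility and flatness the Lie derivative is the symmetrization of the
covariant derivative of the pair of fields that is metrically dual to `Z`. -/
theorem lieDeriv_bigMetric {Z V W : E × E → E × E} {p : E × E} (a b c : ℝ)
    (hZ : DifferentiableAt ℝ Z p)
    (hV : DifferentiableAt ℝ V p) (hW : DifferentiableAt ℝ W p) (hΓ : DifferentiableAt ℝ Γ p.1)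
    (hs : ∀ᶠ z in 𝓝 p.1, ∀ u v, Γ z u v = Γ z v u) (hR : FlatAt Γ p.1)
    (hG : DifferentiableAt ℝ G p.1) (hc : CompatAt Γ G p.1)
    (hGs : ∀ u v, G p.1 u v = G p.1 v u) {lift : (E × E → E × E) → E × E → E × E}
    (hl : lift = fun V p => ((V p).1, vpart Γ V p)) :
    ∃ L : E × E →L[ℝ] ℝ,
      HasFDerivAt (fun q => bigMetric G a b c q.1 (lift V q) (lift W q)) L p ∧
      L (Z p) - bigMetric G a b c p.1 (lift (VectorField.lieBracket ℝ Z V) p) (lift W p)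
        - bigMetric G a b c p.1 (lift V p) (lift (VectorField.lieBracket ℝ Z W) p)
      = G p.1 (covD Γ (fun q => (a + c) • (Z q).1 + b • vpart Γ Z q) p (lift V p)) (W p).1
        + G p.1 (covD Γ (fun q => b • (Z q).1 + a • vpart Γ Z q) p (lift V p)) (vpart Γ W p)
        + (G p.1 (covD Γ (fun q => (a + c) • (Z q).1 + b • vpart Γ Z q) p (lift W p)) (V p).1
        + G p.1 (covD Γ (fun q => b • (Z q).1 + a • vpart Γ Z q) p (lift W p)) (vpart Γ V p)) := by
  subst hl
  obtain ⟨LZ, hLZ, -⟩ := hasFDerivAt_vpart hZ hΓ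
  obtain ⟨LV, hLV, -⟩ := hasFDerivAt_vpart hV hΓ
  obtain ⟨LW, hLW, -⟩ := hasFDerivAt_vpart hW hΓ
  -- the derivative of `g (e, f)` for fields `e`, `f` along the projection
  have key : ∀ e f : E × E → E, DifferentiableAt ℝ e p → DifferentiableAt ℝ f p →
      ∃ L : E × E →L[ℝ] ℝ, HasFDerivAt (fun q => G q.1 (e q) (f q)) L p ∧
        L (Z p) = G p.1 (covD Γ e p ((Z p).1, vpart Γ Z p)) (f p)
          + G p.1 (e p) (covD Γ f p ((Z p).1, vpart Γ Z p)) := by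
    intro e f he hf
    have h0 : HasFDerivAt (fun q : E × E => G q.1) _ p := hG.hasFDerivAt.comp p hasFDerivAt_fst
    refine ⟨_, (h0.clm_apply he.hasFDerivAt).clm_apply hf.hasFDerivAt, ?_⟩
    have := hc (Z p).1 (e p) (f p)
    simp [covD_fst_vpart, this]
    ring
  have hV1 := hV.fst
  have hW1 := hW.fst
  obtain ⟨L1, h1, h1'⟩ := key _ _ hV1 hW1
  obtain ⟨L2, h2, h2'⟩ := key _ _ hLV.differentiableAt hLW.differentiableAt
  obtain ⟨L3, h3, h3'⟩ := key _ _ hV1 hLW.differentiableAt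
  obtain ⟨L4, h4, h4'⟩ := key _ _ hLV.differentiableAt hW1
  refine ⟨_, (((h1.fun_add h2).const_mul a).fun_add ((h3.fun_add h4).const_mul b)).fun_add
    (h1.const_mul c), ?_⟩
  have hcomb : ∀ (r s : ℝ) (X : E × E),
      covD Γ (fun q => r • (Z q).1 + s • vpart Γ Z q) p X
        = r • covD Γ (fun q => (Z q).1) p X + s • covD Γ (vpart Γ Z) p X := by
    intro r s X
    have := ((hZ.fst.hasFDerivAt.const_smul r).add
      (hLZ.differentiableAt.hasFDerivAt.const_smul s)).fderiv
    rw [covD, covD, covD]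
    erw [this]
    simp only [add_apply, smul_apply, map_add, map_smul, smul_add]
    abel
  have hv : ∀ V : E × E → E × E, vpart Γ V p = (V p).2 + Γ p.1 p.2 (V p).1 := fun _ => rfl
  simp only [hcomb, bigMetric]
  rw [hv (VectorField.lieBracket ℝ Z V), hv (VectorField.lieBracket ℝ Z W),
    lieBracket_vpart hZ hV hΓ hs hR, lieBracket_vpart hZ hW hΓ hs hR,
    lieBracket_fst hZ hV hs.self_of_nhds, lieBracket_fst hZ hW hs.self_of_nhds]
  simp only [add_apply, smul_apply, smul_eq_mul, h1', h2', h3', h4', map_add, map_sub, map_smul,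
    sub_apply]
  rw [hGs (V p).1 (covD Γ (fun q => (Z q).1) p ((W p).1, vpart Γ W p)),
    hGs (vpart Γ V p) (covD Γ (fun q => (Z q).1) p ((W p).1, vpart Γ W p)),
    hGs (V p).1 (covD Γ (vpart Γ Z) p ((W p).1, vpart Γ W p)),
    hGs (vpart Γ V p) (covD Γ (vpart Γ Z) p ((W p).1, vpart Γ W p))]
  ring

end LieLocal

/-! ### Vector fields in the preferred charts -/

section Charts

variable {F : Type*} [NormedAddCommGroup F] [NormedSpace ℝ F]
  {H : Type*} [TopologicalSpace H] {J : ModelWithCorners ℝ F H} [J.Boundaryless]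
  {N : Type*} [TopologicalSpace N] [ChartedSpace H N] [IsManifold J ∞ N]

variable (J) in
/-- The components of the vector field `V` in the preferred chart at `q₀`. -/
def cfield (q₀ : N) (V : Π q : N, TangentSpace J q) (z : F) : F :=
  tangentCoordChange J ((extChartAt J q₀).symm z) q₀ ((extChartAt J q₀).symm z)
    (V ((extChartAt J q₀).symm z))

variable (J) in
/-- The derivative at `z` of the inverse of the preferred chart at `q₀`. -/
def frame (q₀ : N) (z : F) : F →L[ℝ] F :=
  tangentCoordChange J q₀ ((extChartAt J q₀).symm z) ((extChartAt J q₀).symm z)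

theorem tangentCoordChange_frame {q₀ : N} {z : F} (hz : z ∈ (extChartAt J q₀).target) (v : F) :
    tangentCoordChange J ((extChartAt J q₀).symm z) q₀ ((extChartAt J q₀).symm z)
      (frame J q₀ z v) = v := by
  have hq := (extChartAt J q₀).map_target hz
  rw [frame, tangentCoordChange_comp ⟨⟨hq, mem_extChartAt_source _⟩, hq⟩,
    tangentCoordChange_self hq]

theorem frame_tangentCoordChange {q₀ : N} {z : F} (hz : z ∈ (extChartAt J q₀).target) (v : F) :
    frame J q₀ z (tangentCoordChange J ((extChartAt J q₀).symm z) q₀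
      ((extChartAt J q₀).symm z) v) = v := by
  have hq := (extChartAt J q₀).map_target hz
  rw [frame, tangentCoordChange_comp ⟨⟨mem_extChartAt_source _, hq⟩, mem_extChartAt_source _⟩,
    tangentCoordChange_self (mem_extChartAt_source _)]

theorem frame_cfield {q₀ : N} {z : F} (hz : z ∈ (extChartAt J q₀).target)
    (V : Π q : N, TangentSpace J q) :
    frame J q₀ z (cfield J q₀ V z) = V ((extChartAt J q₀).symm z) :=
  frame_tangentCoordChange hz (V _)

/-- The frame as an isomorphism. -/
def frameEquiv {q₀ : N} {z : F} (hz : z ∈ (extChartAt J q₀).target) : F ≃L[ℝ] F :=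
  ContinuousLinearEquiv.equivOfInverse (frame J q₀ z)
    (tangentCoordChange J ((extChartAt J q₀).symm z) q₀ ((extChartAt J q₀).symm z))
    (tangentCoordChange_frame hz) (frame_tangentCoordChange hz)

theorem frame_center (q₀ : N) (v : F) : frame J q₀ (extChartAt J q₀ q₀) v = v := by
  rw [frame, extChartAt_to_inv]
  exact tangentCoordChange_self (mem_extChartAt_source _)

theorem cfield_sub (q₀ : N) (V W : Π q : N, TangentSpace J q) (z : F) :
    cfield J q₀ (V - W) z = cfield J q₀ V z - cfield J q₀ W z :=
  map_sub (tangentCoordChange J ((extChartAt J q₀).symm z) q₀ ((extChartAt J q₀).symm z)) _ _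

theorem cfield_center (q₀ : N) (V : Π q : N, TangentSpace J q) :
    cfield J q₀ V (extChartAt J q₀ q₀) = V q₀ := by
  have h := frame_cfield (mem_extChartAt_target (I := J) q₀) V
  rw [frame_center] at h
  refine h.trans ?_
  rw [extChartAt_to_inv]

theorem extChartAt_target_mem_nhds_of_mem {q₀ : N} {z : F} (hz : z ∈ (extChartAt J q₀).target) :
    (extChartAt J q₀).target ∈ 𝓝 z :=
  (isOpen_extChartAt_target q₀).mem_nhds hz

/-- A function on a manifold is `C^n` when its expression in a chart is. -/
theorem contMDiffAt_iff_chart {F' : Type*} [NormedAddCommGroup F'] [NormedSpace ℝ F']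
    {n : ℕ∞ω} (hn : n ≤ ∞)
    {q₀ : N} {z : F} (hz : z ∈ (extChartAt J q₀).target) {φ : N → F'} :
    ContMDiffAt J 𝓘(ℝ, F') n φ ((extChartAt J q₀).symm z) ↔
      ContDiffAt ℝ n (φ ∘ (extChartAt J q₀).symm) z := by
  have : IsManifold J n N := IsManifold.of_le hn
  have hq := (extChartAt J q₀).map_target hz
  rw [← contMDiffAt_iff_contDiffAt]
  constructor
  · intro h
    exact h.comp z ((contMDiffOn_extChartAt_symm q₀).contMDiffAt
      (extChartAt_target_mem_nhds_of_mem hz))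
  · intro h
    have h1 : ContMDiffAt J 𝓘(ℝ, F) n (extChartAt J q₀) ((extChartAt J q₀).symm z) :=
      contMDiffAt_extChartAt' (by rwa [extChartAt_source] at hq)
    rw [← (extChartAt J q₀).right_inv hz] at h
    refine (h.comp _ h1).congr_of_eventuallyEq ?_
    filter_upwards [extChartAt_source_mem_nhds' hq] with q hq
    rw [Function.comp_apply, Function.comp_apply, (extChartAt J q₀).left_inv hq]

variable (J) in
/-- The vector field `V` is `C^n` at `q`. -/
def CnAt (n : ℕ∞ω) (V : Π q : N, TangentSpace J q) (q : N) : Prop :=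
  ContMDiffAt J J.tangent n (fun q' => (⟨q', V q'⟩ : TangentBundle J N)) q

theorem SmoothAt.c1 {V : Π q : N, TangentSpace J q} {q : N} (h : SmoothAt J V q) :
    CnAt J 1 V q :=
  ContMDiffAt.of_le h (by simp)

theorem cnAt_iff {n : ℕ∞ω} (hn : n ≤ ∞) {q₀ : N} {z : F} (hz : z ∈ (extChartAt J q₀).target)
    {V : Π q : N, TangentSpace J q} :
    CnAt J n V ((extChartAt J q₀).symm z) ↔ ContDiffAt ℝ n (cfield J q₀ V) z := by
  have : ContMDiffVectorBundle n F (TangentSpace J : N → Type _) J :=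
    ContMDiffVectorBundle.of_le hn
  have hq := (extChartAt J q₀).map_target hz
  have h := (trivializationAt F (TangentSpace J : N → Type _) q₀).contMDiffAt_section_iff
    (IB := J) (n := n) (s := V) (x₀ := (extChartAt J q₀).symm z)
    (by rwa [extChartAt_source] at hq)
  exact h.trans (contMDiffAt_iff_chart hn hz)

theorem smoothAt_iff {q₀ : N} {z : F} (hz : z ∈ (extChartAt J q₀).target)
    {V : Π q : N, TangentSpace J q} :
    SmoothAt J V ((extChartAt J q₀).symm z) ↔ ContDiffAt ℝ ∞ (cfield J q₀ V) z :=
  cnAt_iff le_rfl hz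

theorem SmoothAt.cfield {q₀ : N} {z : F} (hz : z ∈ (extChartAt J q₀).target)
    {V : Π q : N, TangentSpace J q} (h : SmoothAt J V ((extChartAt J q₀).symm z)) :
    ContDiffAt ℝ ∞ (cfield J q₀ V) z := (smoothAt_iff hz).1 h

/-- The differential of a function in terms of its expression in a chart. -/
theorem mvfderiv_eq {F' : Type*} [NormedAddCommGroup F'] [NormedSpace ℝ F']
    {q₀ : N} {z : F} (hz : z ∈ (extChartAt J q₀).target) {φ : N → F'} {L : F →L[ℝ] F'}
    (h : HasFDerivAt (fun w => φ ((extChartAt J q₀).symm w)) L z)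
    (v : TangentSpace J ((extChartAt J q₀).symm z)) :
    mvfderiv J φ ((extChartAt J q₀).symm z) v = L (tangentCoordChange J
      ((extChartAt J q₀).symm z) q₀ ((extChartAt J q₀).symm z) v) := by
  have hq := (extChartAt J q₀).map_target hz
  set q := (extChartAt J q₀).symm z with hqdef
  have hzq : extChartAt J q₀ q = z := (extChartAt J q₀).right_inv hz
  have ht : HasFDerivAt (extChartAt J q₀ ∘ (extChartAt J q).symm)
      (tangentCoordChange J q q₀ q) (extChartAt J q q) := by
    have := hasFDerivWithinAt_tangentCoordChange (I := J) (x := q) (y := q₀) (z := q)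
      ⟨mem_extChartAt_source _, hq⟩
    rwa [J.range_eq_univ, hasFDerivWithinAt_univ] at this
  have hc : HasFDerivAt (φ ∘ (extChartAt J q).symm) (L.comp (tangentCoordChange J q q₀ q))
      (extChartAt J q q) := by
    have h' : HasFDerivAt (fun w => φ ((extChartAt J q₀).symm w)) L
        ((extChartAt J q₀ ∘ (extChartAt J q).symm) (extChartAt J q q)) := by
      rwa [Function.comp_apply, extChartAt_to_inv, hzq]
    refine (h'.comp _ ht).congr_of_eventuallyEq ?_
    have : ∀ᶠ w in 𝓝 (extChartAt J q q), (extChartAt J q).symm w ∈ (extChartAt J q₀).source := by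
      refine (continuousAt_extChartAt_symm q).eventually ?_
      rw [extChartAt_to_inv]
      exact extChartAt_source_mem_nhds' hq
    filter_upwards [this] with w hw
    rw [Function.comp_apply, Function.comp_apply, Function.comp_apply,
      (extChartAt J q₀).left_inv hw]
  have hm : HasMFDerivAt J 𝓘(ℝ, F') φ q ((L.comp (tangentCoordChange J q q₀ q) : F →L[ℝ] F')) := by
    refine ⟨?_, ?_⟩
    · have h1 : ContinuousAt (fun w => φ ((extChartAt J q₀).symm w)) (extChartAt J q₀ q) := by
        rw [hzq]; exact h.continuousAt
      refine (h1.comp (continuousAt_extChartAt' hq)).congr ?_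
      filter_upwards [extChartAt_source_mem_nhds' hq] with q hq
      rw [Function.comp_apply, (extChartAt J q₀).left_inv hq]
    · rw [J.range_eq_univ]
      exact hc.hasFDerivWithinAt
  rw [mvfderiv, hm.mfderiv]
  rfl

theorem mvfderiv_center {F' : Type*} [NormedAddCommGroup F'] [NormedSpace ℝ F']
    {q : N} {φ : N → F'} {L : F →L[ℝ] F'}
    (h : HasFDerivAt (fun w => φ ((extChartAt J q).symm w)) L (extChartAt J q q))
    (v : TangentSpace J q) : mvfderiv J φ q v = L v := by
  have key : ∀ p : N, p = q →
      (∀ v : TangentSpace J p, mvfderiv J φ p v = L (tangentCoordChange J p q p v)) →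
      ∀ v : TangentSpace J q, mvfderiv J φ q v = L v := by
    rintro p rfl h v
    rw [h]
    exact congrArg L (tangentCoordChange_self (mem_extChartAt_source p))
  exact key _ (extChartAt_to_inv q) (mvfderiv_eq (mem_extChartAt_target q) h) v

theorem mfderiv_extChartAt_symm_eq_frame {q₀ : N} {z : F} (hz : z ∈ (extChartAt J q₀).target) :
    mfderiv 𝓘(ℝ, F) J (extChartAt J q₀).symm z = frame J q₀ z := by
  have hq := (extChartAt J q₀).map_target hz
  rw [extChartAt_source] at hq
  have h1 := TangentBundle.symmL_trivializationAt (I := J) hq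
  rw [TangentBundle.symmL_trivializationAt_eq_core hq, (extChartAt J q₀).right_inv hz,
    J.range_eq_univ, mfderivWithin_univ] at h1
  exact h1.symm

theorem mpullback_eq_cfield {q₀ : N} {z : F} (hz : z ∈ (extChartAt J q₀).target)
    (V : Π q : N, TangentSpace J q) :
    VectorField.mpullback 𝓘(ℝ, F) J (extChartAt J q₀).symm V z = cfield J q₀ V z := by
  rw [VectorField.mpullback_apply, mfderiv_extChartAt_symm_eq_frame hz]
  have : frame J q₀ z = (frameEquiv hz : F →L[ℝ] F) := rfl
  erw [this, ContinuousLinearMap.inverse_equiv]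
  rfl

theorem cfield_mlieBracket [CompleteSpace F] {q₀ : N} {z : F} (hz : z ∈ (extChartAt J q₀).target)
    {V W : Π q : N, TangentSpace J q} (hV : SmoothAt J V ((extChartAt J q₀).symm z))
    (hW : SmoothAt J W ((extChartAt J q₀).symm z)) :
    cfield J q₀ (VectorField.mlieBracket J V W) z
      = VectorField.lieBracket ℝ (cfield J q₀ V) (cfield J q₀ W) z := by
  have hf : ContMDiffAt 𝓘(ℝ, F) J ∞ (extChartAt J q₀).symm z :=
    (contMDiffOn_extChartAt_symm q₀).contMDiffAt (extChartAt_target_mem_nhds_of_mem hz)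
  have : IsManifold J (minSmoothness ℝ 3) N := by
    rw [minSmoothness_of_isRCLikeNormedField]
    exact IsManifold.of_le (n := ∞) (ENat.natCast_le_of_coe_top_le_withTop le_rfl 3)
  have h := VectorField.mpullback_mlieBracket (I := 𝓘(ℝ, F)) (I' := J) (n := ∞)
    (hV.mdifferentiableAt (by simp)) (hW.mdifferentiableAt (by simp)) hf
    (by rw [minSmoothness_of_isRCLikeNormedField]; exact ENat.natCast_le_of_coe_top_le_withTop le_rfl 2)
  rw [mpullback_eq_cfield hz] at h
  rw [h, ← VectorField.mlieBracketWithin_univ, VectorField.mlieBracketWithin_eq_lieBracketWithin]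
  erw [VectorField.lieBracketWithin_univ]
  refine Filter.EventuallyEq.lieBracket_vectorField_eq ?_ ?_ <;>
  · filter_upwards [extChartAt_target_mem_nhds_of_mem hz] with w hw
    exact mpullback_eq_cfield hw _

variable (J) in
/-- The vector field with constant components `v` in the preferred chart at `q₀`. -/
def constField (q₀ : N) (v : F) (q : N) : TangentSpace J q := tangentCoordChange J q₀ q q v

theorem cfield_constField {q₀ : N} {z : F} (hz : z ∈ (extChartAt J q₀).target) (v : F) :
    cfield J q₀ (constField J q₀ v) z = v :=
  tangentCoordChange_frame hz v

theorem cfield_constField_eventuallyEq {q₀ : N} {z : F} (hz : z ∈ (extChartAt J q₀).target)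
    (v : F) : cfield J q₀ (constField J q₀ v) =ᶠ[𝓝 z] fun _ => v := by
  filter_upwards [extChartAt_target_mem_nhds_of_mem hz] with w hw
  exact cfield_constField hw v

theorem smoothAt_constField {q₀ : N} {z : F} (hz : z ∈ (extChartAt J q₀).target) (v : F) :
    SmoothAt J (constField J q₀ v) ((extChartAt J q₀).symm z) :=
  (smoothAt_iff hz).2 (contDiffAt_const.congr_of_eventuallyEq (cfield_constField_eventuallyEq hz v))

end Charts

/-! ### The Levi-Civita connection in the preferred charts -/

section BaseCharts

variable {E : Type*} [NormedAddCommGroup E] [NormedSpace ℝ E] [FiniteDimensional ℝ E]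
  {M : Type*} [TopologicalSpace M] [ChartedSpace E M] [IsManifold 𝓘(ℝ, E) ∞ M]
  (g : Metric E M)

/-- The components of the metric in the preferred chart at `x₀`, as a function on the model
space. -/
def gl (x₀ : M) (y : E) : E →L[ℝ] E →L[ℝ] ℝ :=
  localMetric g x₀ ((extChartAt 𝓘(ℝ, E) x₀).symm y)

/-- The Christoffel symbols in the preferred chart at `x₀`, as a function on the model space. -/
def cl (x₀ : M) : E → E →L[ℝ] E →L[ℝ] E := chr (gl g x₀)

variable {x₀ : M} {y : E}

theorem gl_apply (hy : y ∈ (extChartAt 𝓘(ℝ, E) x₀).target) (v w : E) :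
    gl g x₀ y v w = g.inner ((extChartAt 𝓘(ℝ, E) x₀).symm y) (frame 𝓘(ℝ, E) x₀ y v)
      (frame 𝓘(ℝ, E) x₀ y w) := by
  have hq := (extChartAt 𝓘(ℝ, E) x₀).map_target hy
  rw [extChartAt_source] at hq
  rw [gl, localMetric_apply g _ _ hq]
  have h := TangentBundle.symmL_trivializationAt_eq_core (I := 𝓘(ℝ, E)) hq
  have h' : ∀ v, (trivializationAt E (fun y : M => TangentSpace 𝓘(ℝ, E) y) x₀).symm
      ((extChartAt 𝓘(ℝ, E) x₀).symm y) v = frame 𝓘(ℝ, E) x₀ y v := fun v =>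
    (Bundle.Trivialization.symmL_apply (R := ℝ) _ hq v).symm.trans (DFunLike.congr_fun h v)
  rw [h', h']

theorem gl_symm (hy : y ∈ (extChartAt 𝓘(ℝ, E) x₀).target) (v w : E) :
    gl g x₀ y v w = gl g x₀ y w v := by
  rw [gl_apply g hy, gl_apply g hy]
  exact g.symm _ _ _

theorem gl_symm_eventually (hy : y ∈ (extChartAt 𝓘(ℝ, E) x₀).target) :
    ∀ᶠ z in 𝓝 y, ∀ v w, gl g x₀ z v w = gl g x₀ z w v := by
  filter_upwards [extChartAt_target_mem_nhds_of_mem hy] with z hz using gl_symm g hz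

theorem gl_isInvertible (hy : y ∈ (extChartAt 𝓘(ℝ, E) x₀).target) :
    (gl g x₀ y).IsInvertible := by
  obtain ⟨e, he⟩ := metric_isInvertible g ((extChartAt 𝓘(ℝ, E) x₀).symm y)
  let e' : E ≃L[ℝ] (E →L[ℝ] ℝ) := e
  refine ⟨((frameEquiv hy).trans e').trans
    ((frameEquiv hy).arrowCongr (ContinuousLinearEquiv.refl ℝ ℝ)).symm, ?_⟩
  ext v w
  rw [gl_apply g hy, ← he]
  rfl

theorem gl_contDiffAt (hy : y ∈ (extChartAt 𝓘(ℝ, E) x₀).target) :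
    ContDiffAt ℝ ∞ (gl g x₀) y := by
  have hq := (extChartAt 𝓘(ℝ, E) x₀).map_target hy
  rw [extChartAt_source] at hq
  have h := (trivializationAt (E →L[ℝ] E →L[ℝ] ℝ)
    (fun y : M => TangentSpace 𝓘(ℝ, E) y →L[ℝ] TangentSpace 𝓘(ℝ, E) y →L[ℝ] ℝ)
    x₀).contMDiffAt_section_iff (IB := 𝓘(ℝ, E)) (n := ∞) (s := g.inner)
    (x₀ := (extChartAt 𝓘(ℝ, E) x₀).symm y) (by simpa using hq)
  exact (contMDiffAt_iff_chart le_rfl hy).1 (h.1 g.contMDiff.contMDiffAt)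

theorem gl_differentiableAt (hy : y ∈ (extChartAt 𝓘(ℝ, E) x₀).target) :
    DifferentiableAt ℝ (gl g x₀) y := (gl_contDiffAt g hy).differentiableAt (by simp)

theorem cl_contDiffAt (hy : y ∈ (extChartAt 𝓘(ℝ, E) x₀).target) :
    ContDiffAt ℝ ∞ (cl g x₀) y := by
  have := FiniteDimensional.complete ℝ E
  exact contDiffAt_chr (gl_contDiffAt g hy) (gl_isInvertible g hy)

theorem cl_differentiableAt (hy : y ∈ (extChartAt 𝓘(ℝ, E) x₀).target) :
    DifferentiableAt ℝ (cl g x₀) y := (cl_contDiffAt g hy).differentiableAt (by simp)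

theorem cl_symm (hy : y ∈ (extChartAt 𝓘(ℝ, E) x₀).target) (v w : E) :
    cl g x₀ y v w = cl g x₀ y w v :=
  chr_symm (gl_differentiableAt g hy) (gl_isInvertible g hy) (gl_symm_eventually g hy) v w

theorem cl_symm_eventually (hy : y ∈ (extChartAt 𝓘(ℝ, E) x₀).target) :
    ∀ᶠ z in 𝓝 y, ∀ v w, cl g x₀ z v w = cl g x₀ z w v := by
  filter_upwards [extChartAt_target_mem_nhds_of_mem hy] with z hz using cl_symm g hz

theorem cl_compatAt (hy : y ∈ (extChartAt 𝓘(ℝ, E) x₀).target) :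
    CompatAt (cl g x₀) (gl g x₀) y :=
  chr_compatAt (gl_differentiableAt g hy) (gl_isInvertible g hy) (gl_symm_eventually g hy)

theorem gl_nondegenerate (hy : y ∈ (extChartAt 𝓘(ℝ, E) x₀).target) (v : E)
    (h : ∀ w, gl g x₀ y v w = 0) : v = 0 :=
  eq_of_inner_eq (gl_isInvertible g hy) fun w => by simp [h w]

theorem gl_center (x : M) : gl g x (extChartAt 𝓘(ℝ, E) x x) = g.inner x := by
  ext v w
  rw [gl_apply g (mem_extChartAt_target x), frame_center, frame_center, extChartAt_to_inv]
  rfl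

theorem christoffel_eq_cl (x : M) : christoffel g x = cl g x (extChartAt 𝓘(ℝ, E) x x) := by
  have h : metricDeriv g x = fderiv ℝ (gl g x) (extChartAt 𝓘(ℝ, E) x x) := by
    ext v
    exact congrArg (fun L : E →L[ℝ] E →L[ℝ] ℝ => L _ _) (mvfderiv_center
      (gl_differentiableAt g (mem_extChartAt_target x)).hasFDerivAt v)
  have h2 := gl_center g x
  rw [cl, chr, christoffel, h, h2]
  rfl

theorem cov_eq_center {x : M} {Y : Π x : M, TangentSpace 𝓘(ℝ, E) x}
    (hY : CnAt 𝓘(ℝ, E) 1 Y x) (v : E) :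
    cov g Y x v = covB (cl g x) (cfield 𝓘(ℝ, E) x Y) (extChartAt 𝓘(ℝ, E) x x) v := by
  have h1 : ContDiffAt ℝ 1 (cfield 𝓘(ℝ, E) x Y) (extChartAt 𝓘(ℝ, E) x x) := by
    rw [← cnAt_iff (by simp) (mem_extChartAt_target x), extChartAt_to_inv]
    exact hY
  have h2 : fieldDeriv Y x v = fderiv ℝ (cfield 𝓘(ℝ, E) x Y) (extChartAt 𝓘(ℝ, E) x x) v :=
    mvfderiv_center (h1.differentiableAt (by simp)).hasFDerivAt v
  rw [covB, ← h2, cfield_center, ← christoffel_eq_cl]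
  rfl

end BaseCharts

/-! ### Changes of charts -/

section Transition

variable {F : Type*} [NormedAddCommGroup F] [NormedSpace ℝ F]
  {H : Type*} [TopologicalSpace H] (J : ModelWithCorners ℝ F H) [J.Boundaryless]
  {N : Type*} [TopologicalSpace N] [ChartedSpace H N] [IsManifold J ∞ N] {q₀ : N} {z : F}

/-- The change of coordinates from the preferred chart at `q₀` to the one at the point with
coordinates `z`. -/
def trans (q₀ : N) (z : F) : F → F :=
  extChartAt J ((extChartAt J q₀).symm z) ∘ (extChartAt J q₀).symm

variable {J}

theorem trans_self (q₀ : N) (z : F) :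
    trans J q₀ z z = extChartAt J ((extChartAt J q₀).symm z) ((extChartAt J q₀).symm z) := rfl

theorem eventually_mem_trans {q₀ : N} {z : F} (hz : z ∈ (extChartAt J q₀).target) :
    ∀ᶠ w in 𝓝 z, w ∈ (extChartAt J q₀).target ∧
      (extChartAt J q₀).symm w ∈ (extChartAt J ((extChartAt J q₀).symm z)).source := by
  filter_upwards [extChartAt_target_mem_nhds_of_mem hz,
    (continuousAt_extChartAt_symm'' hz).eventually (extChartAt_source_mem_nhds (I := J)
      ((extChartAt J q₀).symm z))] with w h1 h2 using ⟨h1, h2⟩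

theorem trans_contDiffAt (hz : z ∈ (extChartAt J q₀).target) :
    ContDiffAt ℝ ∞ (trans J q₀ z) z := by
  have h := contDiffWithinAt_ext_coord_change (I := J) (M := N) (n := ∞)
    ((extChartAt J q₀).symm z) q₀
    (y := z) (by
      rw [PartialEquiv.trans_source, PartialEquiv.symm_source]
      exact ⟨hz, mem_extChartAt_source _⟩)
  rwa [J.range_eq_univ, contDiffWithinAt_univ] at h

theorem fderiv_trans (hz : z ∈ (extChartAt J q₀).target) :
    ∀ᶠ w in 𝓝 z, fderiv ℝ (trans J q₀ z) w
      = tangentCoordChange J q₀ ((extChartAt J q₀).symm z) ((extChartAt J q₀).symm w) := by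
  filter_upwards [eventually_mem_trans hz] with w hw
  have h := hasFDerivWithinAt_tangentCoordChange (I := J)
    ⟨(extChartAt J q₀).map_target hw.1, hw.2⟩
  rw [J.range_eq_univ, hasFDerivWithinAt_univ, (extChartAt J q₀).right_inv hw.1] at h
  exact h.fderiv

theorem fderiv_trans_self (hz : z ∈ (extChartAt J q₀).target) :
    fderiv ℝ (trans J q₀ z) z = frame J q₀ z :=
  (fderiv_trans hz).self_of_nhds

theorem extChartAt_symm_trans (hz : z ∈ (extChartAt J q₀).target) :
    ∀ᶠ w in 𝓝 z, (extChartAt J ((extChartAt J q₀).symm z)).symm (trans J q₀ z w)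
      = (extChartAt J q₀).symm w := by
  filter_upwards [eventually_mem_trans hz] with w hw
  exact (extChartAt J ((extChartAt J q₀).symm z)).left_inv hw.2

theorem frame_trans (hz : z ∈ (extChartAt J q₀).target) :
    ∀ᶠ w in 𝓝 z, ∀ v, frame J ((extChartAt J q₀).symm z) (trans J q₀ z w)
      (fderiv ℝ (trans J q₀ z) w v) = frame J q₀ w v := by
  filter_upwards [eventually_mem_trans hz, fderiv_trans hz, extChartAt_symm_trans hz]
    with w h1 h2 h3 v
  rw [h2, frame, frame, h3, tangentCoordChange_comp ⟨⟨(extChartAt J q₀).map_target h1.1, h1.2⟩,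
    mem_extChartAt_source _⟩]

theorem trans_mem_target (hz : z ∈ (extChartAt J q₀).target) :
    ∀ᶠ w in 𝓝 z, trans J q₀ z w ∈ (extChartAt J ((extChartAt J q₀).symm z)).target := by
  filter_upwards [eventually_mem_trans hz] with w hw
  exact (extChartAt J _).map_source hw.2

theorem cfield_trans (hz : z ∈ (extChartAt J q₀).target) (V : Π q : N, TangentSpace J q) :
    ∀ᶠ w in 𝓝 z, cfield J ((extChartAt J q₀).symm z) V (trans J q₀ z w)
      = fderiv ℝ (trans J q₀ z) w (cfield J q₀ V w) := by
  filter_upwards [eventually_mem_trans hz, fderiv_trans hz, extChartAt_symm_trans hz]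
    with w h1 h2 h3
  rw [h2, cfield, cfield, h3]
  exact (tangentCoordChange_comp (E := F) (v := (V ((extChartAt J q₀).symm w) : F))
    ⟨⟨mem_extChartAt_source _, (extChartAt J q₀).map_target h1.1⟩, h1.2⟩).symm

end Transition

/-! ### The connection and its curvature in a fixed chart -/

section BaseCharts

variable {E : Type*} [NormedAddCommGroup E] [NormedSpace ℝ E] [FiniteDimensional ℝ E]
  {M : Type*} [TopologicalSpace M] [ChartedSpace E M] [IsManifold 𝓘(ℝ, E) ∞ M]
  (g : Metric E M) {x₀ : M} {y : E}

/-- The transformation law of the Christoffel symbols, from the preferred chart at `x₀` to the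
preferred chart at a nearby point. -/
theorem christoffel_frame (hy : y ∈ (extChartAt 𝓘(ℝ, E) x₀).target) (u v : E) :
    frame 𝓘(ℝ, E) x₀ y (cl g x₀ y u v)
      = christoffel g ((extChartAt 𝓘(ℝ, E) x₀).symm y) (frame 𝓘(ℝ, E) x₀ y u)
          (frame 𝓘(ℝ, E) x₀ y v)
        + fderiv ℝ (fderiv ℝ (trans 𝓘(ℝ, E) x₀ y)) y u v := by
  have hc : trans 𝓘(ℝ, E) x₀ y y
      ∈ (extChartAt 𝓘(ℝ, E) ((extChartAt 𝓘(ℝ, E) x₀).symm y)).target :=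
    (trans_mem_target hy).self_of_nhds
  rw [← fderiv_trans_self hy, christoffel_eq_cl, ← trans_self]
  refine chr_transform ((trans_contDiffAt hy).of_le (ENat.natCast_le_of_coe_top_le_withTop le_rfl 2)) ?_
    (gl_differentiableAt g hc) (gl_isInvertible g hy) (gl_isInvertible g hc) (gl_symm g hc)
    (gl_differentiableAt g hy) ?_ u v
  · rw [fderiv_trans_self hy]
    exact ⟨frameEquiv hy, rfl⟩
  · filter_upwards [extChartAt_target_mem_nhds_of_mem hy, trans_mem_target hy, frame_trans hy,
      extChartAt_symm_trans hy] with w h1 h2 h3 h4 u v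
    rw [gl_apply g h1, gl_apply g h2, h3, h3, h4]

/-- The Levi-Civita connection, computed in the preferred chart at `x₀`. -/
theorem cov_eq (hy : y ∈ (extChartAt 𝓘(ℝ, E) x₀).target) {Y : Π x : M, TangentSpace 𝓘(ℝ, E) x}
    (hY : CnAt 𝓘(ℝ, E) 1 Y ((extChartAt 𝓘(ℝ, E) x₀).symm y)) (v : E) :
    cov g Y ((extChartAt 𝓘(ℝ, E) x₀).symm y) (frame 𝓘(ℝ, E) x₀ y v)
      = frame 𝓘(ℝ, E) x₀ y (covB (cl g x₀) (cfield 𝓘(ℝ, E) x₀ Y) y v) := by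
  have hc : trans 𝓘(ℝ, E) x₀ y y
      ∈ (extChartAt 𝓘(ℝ, E) ((extChartAt 𝓘(ℝ, E) x₀).symm y)).target :=
    (trans_mem_target hy).self_of_nhds
  have h1 : CnAt 𝓘(ℝ, E) 1 Y ((extChartAt 𝓘(ℝ, E)
      ((extChartAt 𝓘(ℝ, E) x₀).symm y)).symm (trans 𝓘(ℝ, E) x₀ y y)) := by
    rw [(extChartAt_symm_trans hy).self_of_nhds]; exact hY
  rw [cov_eq_center g hY, ← fderiv_trans_self hy, ← trans_self]
  refine covB_transform ((trans_contDiffAt hy).of_le (ENat.natCast_le_of_coe_top_le_withTop le_rfl 2))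
    (((cnAt_iff (by simp) hc).1 h1).differentiableAt (by simp))
    (((cnAt_iff (by simp) hy).1 hY).differentiableAt (by simp)) (cfield_trans hy Y) ?_ v
  intro u v
  have := christoffel_frame g hy u v
  rwa [← fderiv_trans_self hy, christoffel_eq_cl, ← trans_self] at this

theorem cfield_nabla (hy : y ∈ (extChartAt 𝓘(ℝ, E) x₀).target)
    {X Y : Π x : M, TangentSpace 𝓘(ℝ, E) x}
    (hY : CnAt 𝓘(ℝ, E) 1 Y ((extChartAt 𝓘(ℝ, E) x₀).symm y)) :
    cfield 𝓘(ℝ, E) x₀ (nabla g X Y) y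
      = covB (cl g x₀) (cfield 𝓘(ℝ, E) x₀ Y) y (cfield 𝓘(ℝ, E) x₀ X y) := by
  apply (frameEquiv hy).injective
  refine (frame_cfield hy _).trans ?_
  refine Eq.trans ?_ (cov_eq g hy hY (cfield 𝓘(ℝ, E) x₀ X y))
  rw [frame_cfield hy]
  rfl

theorem cfield_nabla_eventuallyEq (hy : y ∈ (extChartAt 𝓘(ℝ, E) x₀).target)
    {X Y : Π x : M, TangentSpace 𝓘(ℝ, E) x}
    (hY : SmoothAt 𝓘(ℝ, E) Y ((extChartAt 𝓘(ℝ, E) x₀).symm y)) :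
    cfield 𝓘(ℝ, E) x₀ (nabla g X Y) =ᶠ[𝓝 y]
      fun z => covB (cl g x₀) (cfield 𝓘(ℝ, E) x₀ Y) z (cfield 𝓘(ℝ, E) x₀ X z) := by
  have h := ((cnAt_iff (J := 𝓘(ℝ, E)) (n := 1) (by simp) hy).1 hY.c1).eventually (by simp)
  filter_upwards [h, extChartAt_target_mem_nhds_of_mem hy] with z h1 h2
  exact cfield_nabla g h2 ((cnAt_iff (by simp) h2).2 h1)

theorem contDiffAt_covB {n : ℕ∞ω} {Γ : E → E →L[ℝ] E →L[ℝ] E} {X V : E → E}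
    (hΓ : ContDiffAt ℝ n Γ y) (hX : ContDiffAt ℝ (n + 1) X y) (hV : ContDiffAt ℝ n V y) :
    ContDiffAt ℝ n (fun z => covB Γ X z (V z)) y :=
  ((hX.fderiv_right le_rfl).clm_apply hV).add
    ((hΓ.clm_apply hV).clm_apply (hX.of_le le_self_add))

theorem smoothAt_nabla (hy : y ∈ (extChartAt 𝓘(ℝ, E) x₀).target)
    {X Y : Π x : M, TangentSpace 𝓘(ℝ, E) x}
    (hX : SmoothAt 𝓘(ℝ, E) X ((extChartAt 𝓘(ℝ, E) x₀).symm y))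
    (hY : SmoothAt 𝓘(ℝ, E) Y ((extChartAt 𝓘(ℝ, E) x₀).symm y)) :
    SmoothAt 𝓘(ℝ, E) (nabla g X Y) ((extChartAt 𝓘(ℝ, E) x₀).symm y) := by
  rw [smoothAt_iff hy]
  exact (contDiffAt_covB (cl_contDiffAt g hy) (hY.cfield hy) (hX.cfield hy)).congr_of_eventuallyEq
    (cfield_nabla_eventuallyEq g hy hY)

/-- The derivative of `∇_V X` along a non-constant field `V`. -/
theorem covB_covB {Γ : E → E →L[ℝ] E →L[ℝ] E} {X V : E → E} (hΓ : DifferentiableAt ℝ Γ y)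
    (hX : ContDiffAt ℝ 2 X y) (hV : DifferentiableAt ℝ V y) (u : E) :
    covB Γ (fun z => covB Γ X z (V z)) y u - covB Γ X y (covB Γ V y u)
      = hessB Γ X y u (V y) := by
  have hX1 : HasFDerivAt X (fderiv ℝ X y) y := (hX.differentiableAt (by norm_num)).hasFDerivAt
  have hX2 : HasFDerivAt (fderiv ℝ X) (fderiv ℝ (fderiv ℝ X) y) y :=
    ((hX.fderiv_right (m := 1) (by norm_num)).differentiableAt (by norm_num)).hasFDerivAt
  have key : ∀ V : E → E, DifferentiableAt ℝ V y → fderiv ℝ (fun z => covB Γ X z (V z)) y u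
      = fderiv ℝ (fderiv ℝ X) y u (V y) + fderiv ℝ X y (fderiv ℝ V y u)
        + (fderiv ℝ Γ y u (V y) (X y) + Γ y (fderiv ℝ V y u) (X y)
        + Γ y (V y) (fderiv ℝ X y u)) := by
    intro V hV
    have h := ((hX2.clm_apply hV.hasFDerivAt).add
      ((hΓ.hasFDerivAt.clm_apply hV.hasFDerivAt).clm_apply hX1)).fderiv
    have h' : fderiv ℝ (fun z => covB Γ X z (V z)) y = _ := h
    rw [h']
    simp
    abel
  have h1 := key V hV
  have h2 := key (fun _ => V y) (differentiableAt_const _)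
  have e1 : covB Γ (fun z => covB Γ X z (V z)) y u = fderiv ℝ (fun z => covB Γ X z (V z)) y u
    + Γ y u (covB Γ X y (V y)) := rfl
  have e2 : covB Γ (fun z => covB Γ X z (V y)) y u = fderiv ℝ (fun z => covB Γ X z (V y)) y u
    + Γ y u (covB Γ X y (V y)) := rfl
  rw [hessB, e1, e2, h1, h2]
  simp [covB]
  abel

theorem cfield_nabla2 (hy : y ∈ (extChartAt 𝓘(ℝ, E) x₀).target)
    {X U V : Π x : M, TangentSpace 𝓘(ℝ, E) x}
    (hX : SmoothAt 𝓘(ℝ, E) X ((extChartAt 𝓘(ℝ, E) x₀).symm y))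
    (hV : SmoothAt 𝓘(ℝ, E) V ((extChartAt 𝓘(ℝ, E) x₀).symm y)) :
    cfield 𝓘(ℝ, E) x₀ (nabla2 g X U V) y = hessB (cl g x₀) (cfield 𝓘(ℝ, E) x₀ X) y
      (cfield 𝓘(ℝ, E) x₀ U y) (cfield 𝓘(ℝ, E) x₀ V y) := by
  have h1 := cfield_nabla g hy (X := U) (smoothAt_nabla g hy hV hX).c1
  have h2 := cfield_nabla g hy (X := nabla g U V) hX.c1
  have h3 := cfield_nabla g hy (X := U) hV.c1
  have hev := cfield_nabla_eventuallyEq g hy (X := V) hX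
  refine (cfield_sub _ _ _ y).trans ?_
  refine (congrArg₂ _ h1 h2).trans ?_
  rw [h3, ← covB_covB (cl_differentiableAt g hy) ((hX.cfield hy).of_le
    (ENat.natCast_le_of_coe_top_le_withTop le_rfl 2)) ((hV.cfield hy).differentiableAt (by simp)),
    covB, hev.fderiv_eq, hev.self_of_nhds]
  rfl

/-- On a flat manifold second covariant derivatives commute. -/
theorem Flat.hessB_symm {g : Metric E M} (hg : Flat g)
    (hy : y ∈ (extChartAt 𝓘(ℝ, E) x₀).target) {X : Π x : M, TangentSpace 𝓘(ℝ, E) x}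
    (hX : SmoothAt 𝓘(ℝ, E) X ((extChartAt 𝓘(ℝ, E) x₀).symm y)) (u v : E) :
    hessB (cl g x₀) (cfield 𝓘(ℝ, E) x₀ X) y u v
      = hessB (cl g x₀) (cfield 𝓘(ℝ, E) x₀ X) y v u := by
  have hU := smoothAt_constField (J := 𝓘(ℝ, E)) hy u
  have hV := smoothAt_constField (J := 𝓘(ℝ, E)) hy v
  have hc := hg _ _ _ _ hU hV hX
  have hbr : cfield 𝓘(ℝ, E) x₀ (VectorField.mlieBracket 𝓘(ℝ, E)
      (constField 𝓘(ℝ, E) x₀ u) (constField 𝓘(ℝ, E) x₀ v)) y = 0 := by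
    have := FiniteDimensional.complete ℝ E
    rw [cfield_mlieBracket hy hU hV, VectorField.lieBracket,
      (cfield_constField_eventuallyEq hy u).fderiv_eq,
      (cfield_constField_eventuallyEq hy v).fderiv_eq]
    simp
  have h0 : cfield 𝓘(ℝ, E) x₀ (curvature g (constField 𝓘(ℝ, E) x₀ u)
      (constField 𝓘(ℝ, E) x₀ v) X) y = 0 := by
    rw [cfield, hc]
    exact map_zero _
  have h1 := cfield_nabla g hy (X := constField 𝓘(ℝ, E) x₀ u) (smoothAt_nabla g hy hV hX).c1
  have h2 := cfield_nabla g hy (X := constField 𝓘(ℝ, E) x₀ v) (smoothAt_nabla g hy hU hX).c1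
  have h3 := cfield_nabla g hy (X := VectorField.mlieBracket 𝓘(ℝ, E)
      (constField 𝓘(ℝ, E) x₀ u) (constField 𝓘(ℝ, E) x₀ v)) hX.c1
  have hev : ∀ v, cfield 𝓘(ℝ, E) x₀ (nabla g (constField 𝓘(ℝ, E) x₀ v) X) =ᶠ[𝓝 y]
      fun z => covB (cl g x₀) (cfield 𝓘(ℝ, E) x₀ X) z v := by
    intro v
    filter_upwards [cfield_nabla_eventuallyEq g hy (X := constField 𝓘(ℝ, E) x₀ v) hX,
      cfield_constField_eventuallyEq hy v] with z h1 h2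
    rw [h1, h2]
  have hcov : ∀ u v, covB (cl g x₀) (cfield 𝓘(ℝ, E) x₀ (nabla g (constField 𝓘(ℝ, E) x₀ v) X)) y u
      = covB (cl g x₀) (fun z => covB (cl g x₀) (cfield 𝓘(ℝ, E) x₀ X) z v) y u := by
    intro u v
    exact covB_congr (hev v) u
  have h4 := (cfield_sub _ _ _ y).symm.trans h0
  rw [cfield_constField hy, hcov] at h1 h2
  rw [hbr] at h3
  have h6 : cfield 𝓘(ℝ, E) x₀ (nabla g (constField 𝓘(ℝ, E) x₀ u)
        (nabla g (constField 𝓘(ℝ, E) x₀ v) X)) y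
      - cfield 𝓘(ℝ, E) x₀ (nabla g (constField 𝓘(ℝ, E) x₀ v)
        (nabla g (constField 𝓘(ℝ, E) x₀ u) X)) y
      - cfield 𝓘(ℝ, E) x₀ (nabla g (VectorField.mlieBracket 𝓘(ℝ, E)
        (constField 𝓘(ℝ, E) x₀ u) (constField 𝓘(ℝ, E) x₀ v)) X) y = 0 :=
    (congrArg (· - _) (cfield_sub _ _ _ y)).symm.trans h4
  rw [h1, h2, h3] at h6
  simp only [covB, map_zero, zero_apply, add_zero, sub_zero] at h6
  rw [hessB, hessB, cl_symm g hy u v]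
  simp only [covB]
  rw [sub_eq_zero] at h6
  rw [h6]

/-- The curvature tensor in coordinates is found by testing `Flat.hessB_symm` on a field with
constant components. -/
theorem Flat.flatAt {g : Metric E M} (hg : Flat g) (hy : y ∈ (extChartAt 𝓘(ℝ, E) x₀).target) :
    FlatAt (cl g x₀) y := by
  intro u v w
  have h := hg.hessB_symm hy (smoothAt_constField (J := 𝓘(ℝ, E)) hy w) u v
  have hev : ∀ v, (fun z => covB (cl g x₀) (cfield 𝓘(ℝ, E) x₀ (constField 𝓘(ℝ, E) x₀ w)) z v)
      =ᶠ[𝓝 y] fun z => cl g x₀ z v w := by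
    intro v
    filter_upwards [eventually_eventually_nhds.2 (cfield_constField_eventuallyEq
      (J := 𝓘(ℝ, E)) hy w)] with z hz
    have hz' : cfield 𝓘(ℝ, E) x₀ (constField 𝓘(ℝ, E) x₀ w) =ᶠ[𝓝 z] fun _ => w := hz
    rw [covB_congr hz']
    simp [covB]
  have hd : ∀ u v, fderiv ℝ (fun z => cl g x₀ z v w) y u = fderiv ℝ (cl g x₀) y u v w := by
    intro u v
    have := (((cl_differentiableAt g hy).hasFDerivAt.clm_apply (hasFDerivAt_const v y)).clm_apply
      (hasFDerivAt_const w y)).fderiv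
    rw [this]
    simp
  have e : ∀ u v, covB (cl g x₀) (fun z => covB (cl g x₀)
      (cfield 𝓘(ℝ, E) x₀ (constField 𝓘(ℝ, E) x₀ w)) z v) y u
      = fderiv ℝ (cl g x₀) y u v w + cl g x₀ y u (cl g x₀ y v w) := by
    intro u v
    have h0 : covB (cl g x₀) (cfield 𝓘(ℝ, E) x₀ (constField 𝓘(ℝ, E) x₀ w)) y v
      = cl g x₀ y v w := (hev v).self_of_nhds
    rw [covB, (hev v).fderiv_eq, hd, h0]
  rw [hessB, hessB, e, e, cl_symm g hy v u, sub_left_inj] at h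
  rw [← sub_eq_zero] at h
  rw [← h]
  abel

end BaseCharts

/-! ### The preferred charts of the tangent bundle -/

section TangentCharts

variable {E : Type*} [NormedAddCommGroup E] [NormedSpace ℝ E] [FiniteDimensional ℝ E]
  {M : Type*} [TopologicalSpace M] [ChartedSpace E M] [IsManifold 𝓘(ℝ, E) ∞ M]
  (g : Metric E M) {x₀ : M} {y u : E}

theorem extChartAt_tangent_apply (p q : TM E M) :
    extChartAt (IT E) p q = (extChartAt 𝓘(ℝ, E) p.1 q.1,
      tangentCoordChange 𝓘(ℝ, E) q.1 p.1 q.1 q.2) := rfl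

theorem extChartAt_tangent_target (p : TM E M) :
    (extChartAt (IT E) p).target = (extChartAt 𝓘(ℝ, E) p.1).target ×ˢ Set.univ := by
  refine (FiberBundle.extChartAt_target (IB := 𝓘(ℝ, E)) (F := E)
    (E := (TangentSpace 𝓘(ℝ, E) : M → Type _)) p).trans ?_
  congr 1
  refine Set.inter_eq_left.2 fun z hz => ?_
  have := (extChartAt 𝓘(ℝ, E) p.1).map_target hz
  rwa [extChartAt_source] at this

theorem mem_tangent_target (p : TM E M) (hy : y ∈ (extChartAt 𝓘(ℝ, E) p.1).target) (u : E) :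
    (y, u) ∈ (extChartAt (IT E) p).target := by
  rw [extChartAt_tangent_target]; exact ⟨hy, trivial⟩

theorem extChartAt_tangent_symm (p : TM E M) (hy : y ∈ (extChartAt 𝓘(ℝ, E) p.1).target) (u : E) :
    (extChartAt (IT E) p).symm (y, u)
      = ⟨(extChartAt 𝓘(ℝ, E) p.1).symm y, frame 𝓘(ℝ, E) p.1 y u⟩ := by
  have hq := (extChartAt 𝓘(ℝ, E) p.1).map_target hy
  have h : (y, u) = extChartAt (IT E) p
      (⟨(extChartAt 𝓘(ℝ, E) p.1).symm y, frame 𝓘(ℝ, E) p.1 y u⟩ : TM E M) := by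
    rw [extChartAt_tangent_apply]
    exact Prod.ext ((extChartAt 𝓘(ℝ, E) p.1).right_inv hy).symm
      (tangentCoordChange_frame hy u).symm
  rw [h, (extChartAt (IT E) p).left_inv]
  rw [extChartAt_source, TangentBundle.mem_chart_source_iff]
  rwa [extChartAt_source] at hq

/-- The coordinate frame of the tangent bundle. Its second derivative term cancels the one in the
transformation law of the Christoffel symbols when the connection map is applied. -/
theorem frame_tangent (p : TM E M) (hy : y ∈ (extChartAt 𝓘(ℝ, E) p.1).target) (v w : E) :
    frame (IT E) p (y, u) (v, w) = (frame 𝓘(ℝ, E) p.1 y v,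
      fderiv ℝ (fderiv ℝ (trans 𝓘(ℝ, E) p.1 y)) y v u + frame 𝓘(ℝ, E) p.1 y w) := by
  have hyu := mem_tangent_target p hy u
  rw [← fderiv_trans_self hyu]
  have hev : trans (IT E) p (y, u) =ᶠ[𝓝 (y, u)] fun q => (trans 𝓘(ℝ, E) p.1 y q.1,
      fderiv ℝ (trans 𝓘(ℝ, E) p.1 y) q.1 q.2) := by
    have h1 := (continuous_fst (X := E) (Y := E)).continuousAt (x := (y, u)) |>.eventually
      ((eventually_mem_trans hy).and (fderiv_trans hy))
    filter_upwards [h1] with ⟨z, w⟩ ⟨h1, h2⟩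
    have hz := h1.1
    have hq := (extChartAt 𝓘(ℝ, E) p.1).map_target hz
    simp only [h2]
    rw [trans, extChartAt_tangent_symm p hy, Function.comp_apply, extChartAt_tangent_symm p hz,
      extChartAt_tangent_apply]
    refine Prod.ext rfl ?_
    exact tangentCoordChange_comp ⟨⟨hq, mem_extChartAt_source _⟩, h1.2⟩
  have hφ : ContDiffAt ℝ ∞ (trans 𝓘(ℝ, E) p.1 y) y := trans_contDiffAt hy
  have hφ1 : HasFDerivAt (fun q : E × E => trans 𝓘(ℝ, E) p.1 y q.1) _ (y, u) :=
    HasFDerivAt.comp (g := trans 𝓘(ℝ, E) p.1 y) (y, u)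
      (hφ.differentiableAt (by simp)).hasFDerivAt hasFDerivAt_fst
  have hφ2 : HasFDerivAt (fun q : E × E => fderiv ℝ (trans 𝓘(ℝ, E) p.1 y) q.1) _ (y, u) :=
    HasFDerivAt.comp (g := fderiv ℝ (trans 𝓘(ℝ, E) p.1 y)) (y, u)
      ((hφ.fderiv_right (m := ∞) (by simp)).differentiableAt (by simp)).hasFDerivAt
      hasFDerivAt_fst
  rw [hev.fderiv_eq, (hφ1.prodMk (hφ2.clm_apply hasFDerivAt_snd)).fderiv]
  simp [fderiv_trans_self hy, add_comm]

/-- The chart of the tangent bundle over the preferred chart at `x₀`. -/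
def pt (x₀ : M) (q : E × E) : TM E M := (extChartAt (IT E) (⟨x₀, 0⟩ : TM E M)).symm q

/-- The components of a vector field on the tangent bundle, in the coordinates over the preferred
chart at `x₀`. -/
def tfield (x₀ : M) (Z : Π p : TM E M, TangentSpace (IT E) p) : E × E → E × E :=
  cfield (IT E) (⟨x₀, 0⟩ : TM E M) Z

theorem pt_eq (hy : y ∈ (extChartAt 𝓘(ℝ, E) x₀).target) (u : E) :
    pt x₀ (y, u) = ⟨(extChartAt 𝓘(ℝ, E) x₀).symm y, frame 𝓘(ℝ, E) x₀ y u⟩ := by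
  rw [pt]
  exact extChartAt_tangent_symm (⟨x₀, 0⟩ : TM E M) hy u

theorem pt_center (x : M) (u : E) :
    pt x (extChartAt 𝓘(ℝ, E) x x, u) = (⟨x, u⟩ : TM E M) := by
  rw [pt_eq (mem_extChartAt_target x), frame_center, extChartAt_to_inv]

theorem dproj_frame (hy : y ∈ (extChartAt 𝓘(ℝ, E) x₀).target) (V : E × E) :
    dproj (pt x₀ (y, u)) (frame (IT E) (⟨x₀, 0⟩ : TM E M) (y, u) V)
      = frame 𝓘(ℝ, E) x₀ y V.1 := by
  have h := frame_tangent (u := u) (⟨x₀, 0⟩ : TM E M) hy V.1 V.2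
  exact congrArg Prod.fst h

theorem conn_frame (hy : y ∈ (extChartAt 𝓘(ℝ, E) x₀).target) (V : E × E) :
    conn g (pt x₀ (y, u)) (frame (IT E) (⟨x₀, 0⟩ : TM E M) (y, u) V)
      = frame 𝓘(ℝ, E) x₀ y (V.2 + cl g x₀ y u V.1) := by
  have key : ∀ p : TM E M, p = ⟨(extChartAt 𝓘(ℝ, E) x₀).symm y, frame 𝓘(ℝ, E) x₀ y u⟩ →
      conn g p (frame (IT E) (⟨x₀, 0⟩ : TM E M) (y, u) V)
        = frame 𝓘(ℝ, E) x₀ y (V.2 + cl g x₀ y u V.1) := by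
    rintro p rfl
    have h := frame_tangent (u := u) (⟨x₀, 0⟩ : TM E M) hy V.1 V.2
    have hsymm := ((trans_contDiffAt (J := 𝓘(ℝ, E)) hy).isSymmSndFDerivAt
      (by rw [minSmoothness_of_isRCLikeNormedField]
          exact ENat.natCast_le_of_coe_top_le_withTop le_rfl 2)).eq u V.1
    rw [map_add, christoffel_frame g hy, hsymm]
    refine (congrArg (fun q : E × E => q.2 + christoffel g ((extChartAt 𝓘(ℝ, E) x₀).symm y)
      (frame 𝓘(ℝ, E) x₀ y u) q.1) h).trans ?_
    simp only
    abel
  exact key _ (pt_eq hy u)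

/-- The horizontal and vertical parts of the field `Z` on `TM`, in coordinates. -/
def hv (x₀ : M) (Z : Π p : TM E M, TangentSpace (IT E) p) (q : E × E) : E × E :=
  ((tfield x₀ Z q).1, vpart (cl g x₀) (tfield x₀ Z) q)

theorem dproj_field (hy : y ∈ (extChartAt 𝓘(ℝ, E) x₀).target)
    (Z : Π p : TM E M, TangentSpace (IT E) p) :
    dproj (pt x₀ (y, u)) (Z (pt x₀ (y, u))) = frame 𝓘(ℝ, E) x₀ y (hv g x₀ Z (y, u)).1 := by
  refine Eq.trans ?_ (dproj_frame (u := u) hy (tfield x₀ Z (y, u)))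
  exact congrArg (dproj (pt x₀ (y, u)))
    (frame_cfield (mem_tangent_target (⟨x₀, 0⟩ : TM E M) hy u) Z).symm

theorem conn_field (hy : y ∈ (extChartAt 𝓘(ℝ, E) x₀).target)
    (Z : Π p : TM E M, TangentSpace (IT E) p) :
    conn g (pt x₀ (y, u)) (Z (pt x₀ (y, u))) = frame 𝓘(ℝ, E) x₀ y (hv g x₀ Z (y, u)).2 := by
  refine Eq.trans ?_ (conn_frame g (u := u) hy (tfield x₀ Z (y, u)))
  exact congrArg (conn g (pt x₀ (y, u)))
    (frame_cfield (mem_tangent_target (⟨x₀, 0⟩ : TM E M) hy u) Z).symm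

theorem metricG_field (hy : y ∈ (extChartAt 𝓘(ℝ, E) x₀).target) (a b c : ℝ)
    (V W : Π p : TM E M, TangentSpace (IT E) p) :
    metricG g a b c (pt x₀ (y, u)) (V (pt x₀ (y, u))) (W (pt x₀ (y, u)))
      = bigMetric (gl g x₀) a b c y (hv g x₀ V (y, u)) (hv g x₀ W (y, u)) := by
  have key : ∀ v w : E, g.inner (pt x₀ (y, u)).1 (frame 𝓘(ℝ, E) x₀ y v) (frame 𝓘(ℝ, E) x₀ y w)
      = gl g x₀ y v w := fun v w => (gl_apply g hy v w).symm
  rw [metricG, sasaki, horMetric, verMetric, dproj_field g hy V, dproj_field g hy W,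
    conn_field g hy V, conn_field g hy W, bigMetric]
  simp only [key]

/-- The field `ζ` along the projection with `G(Z, Xʰ) = g(ζ, X)`, in coordinates. -/
def zetaC (a b c : ℝ) (x₀ : M) (Z : Π p : TM E M, TangentSpace (IT E) p) (q : E × E) : E :=
  (a + c) • (hv g x₀ Z q).1 + b • (hv g x₀ Z q).2

/-- The field `ξ` along the projection with `G(Z, Xᵛ) = g(ξ, X)`, in coordinates. -/
def xiC (a b : ℝ) (x₀ : M) (Z : Π p : TM E M, TangentSpace (IT E) p) (q : E × E) : E :=
  b • (hv g x₀ Z q).1 + a • (hv g x₀ Z q).2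

/-- The Lie derivative of `G` on a flat manifold is the symmetrized covariant derivative of the pair
`(ζ, ξ)`. -/
theorem lieDeriv_metricG {g : Metric E M} (hg : Flat g)
    (hy : y ∈ (extChartAt 𝓘(ℝ, E) x₀).target) (a b c : ℝ)
    {Z V W : Π p : TM E M, TangentSpace (IT E) p} (hZ : SmoothAt (IT E) Z (pt x₀ (y, u)))
    (hV : SmoothAt (IT E) V (pt x₀ (y, u))) (hW : SmoothAt (IT E) W (pt x₀ (y, u))) :
    lieDeriv (IT E) (metricG g a b c) Z V W (pt x₀ (y, u))
      = gl g x₀ y (covD (cl g x₀) (zetaC g a b c x₀ Z) (y, u) (hv g x₀ V (y, u)))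
          (hv g x₀ W (y, u)).1
        + gl g x₀ y (covD (cl g x₀) (xiC g a b x₀ Z) (y, u) (hv g x₀ V (y, u)))
          (hv g x₀ W (y, u)).2
        + (gl g x₀ y (covD (cl g x₀) (zetaC g a b c x₀ Z) (y, u) (hv g x₀ W (y, u)))
          (hv g x₀ V (y, u)).1
        + gl g x₀ y (covD (cl g x₀) (xiC g a b x₀ Z) (y, u) (hv g x₀ W (y, u)))
          (hv g x₀ V (y, u)).2) := by
  have := FiniteDimensional.complete ℝ E
  have hyu := mem_tangent_target (⟨x₀, 0⟩ : TM E M) hy u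
  have dZ : DifferentiableAt ℝ (tfield x₀ Z) (y, u) :=
    (hZ.cfield hyu).differentiableAt (by simp)
  have dV : DifferentiableAt ℝ (tfield x₀ V) (y, u) :=
    (hV.cfield hyu).differentiableAt (by simp)
  have dW : DifferentiableAt ℝ (tfield x₀ W) (y, u) :=
    (hW.cfield hyu).differentiableAt (by simp)
  obtain ⟨L, hL, hL'⟩ := lieDeriv_bigMetric (Γ := cl g x₀) (G := gl g x₀) a b c dZ dV dW
    (cl_differentiableAt g hy) (cl_symm_eventually g hy) (hg.flatAt hy)
    (gl_differentiableAt g hy) (cl_compatAt g hy) (gl_symm g hy) rfl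
  have hBV : ∀ V : Π p : TM E M, TangentSpace (IT E) p, SmoothAt (IT E) V (pt x₀ (y, u)) →
      hv g x₀ (VectorField.mlieBracket (IT E) Z V) (y, u)
      = ((VectorField.lieBracket ℝ (tfield x₀ Z) (tfield x₀ V) (y, u)).1,
        vpart (cl g x₀) (VectorField.lieBracket ℝ (tfield x₀ Z) (tfield x₀ V)) (y, u)) := by
    intro V hV
    have h := cfield_mlieBracket (J := IT E) hyu hZ hV
    have h' : tfield x₀ (VectorField.mlieBracket (IT E) Z V) (y, u)
      = VectorField.lieBracket ℝ (tfield x₀ Z) (tfield x₀ V) (y, u) := h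
    rw [hv, vpart, h', vpart]
  have hd : HasFDerivAt (fun q => metricG g a b c (pt x₀ q) (V (pt x₀ q)) (W (pt x₀ q)))
      L (y, u) := by
    refine hL.congr_of_eventuallyEq ?_
    have h1 := (continuous_fst (X := E) (Y := E)).continuousAt (x := (y, u)) |>.eventually
      (extChartAt_target_mem_nhds_of_mem hy)
    filter_upwards [h1] with ⟨z, w⟩ hz
    exact metricG_field g hz a b c V W
  have hm := mvfderiv_eq (J := IT E) hyu (φ := fun p => metricG g a b c p (V p) (W p)) hd
    (Z (pt x₀ (y, u)))
  have h1 := metricG_field g (u := u) hy a b c (VectorField.mlieBracket (IT E) Z V) W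
  have h2 := metricG_field g (u := u) hy a b c V (VectorField.mlieBracket (IT E) Z W)
  rw [hBV V hV] at h1
  rw [hBV W hW] at h2
  rw [lieDeriv]
  refine Eq.trans ?_ hL'
  refine congrArg₂ (· - ·) (congrArg₂ (· - ·) hm h1) h2

end TangentCharts

/-! ### The conditions of the classification in coordinates -/

section Transfer

variable {E : Type*} [NormedAddCommGroup E] [NormedSpace ℝ E] [FiniteDimensional ℝ E]
  {M : Type*} [TopologicalSpace M] [ChartedSpace E M] [IsManifold 𝓘(ℝ, E) ∞ M]
  {g : Metric E M} {x₀ : M} {y u : E} {a b c μ : ℝ}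
  {Z : Π p : TM E M, TangentSpace (IT E) p}

theorem contDiffAt_tfield (hZ : Smooth (IT E) Z) (hy : y ∈ (extChartAt 𝓘(ℝ, E) x₀).target) (u : E) :
    ContDiffAt ℝ ∞ (tfield x₀ Z) (y, u) :=
  SmoothAt.cfield (mem_tangent_target (⟨x₀, 0⟩ : TM E M) hy u) (hZ _)

theorem contDiffAt_hv (hZ : Smooth (IT E) Z) (hy : y ∈ (extChartAt 𝓘(ℝ, E) x₀).target) (u : E) :
    ContDiffAt ℝ ∞ (hv g x₀ Z) (y, u) := by
  have h := contDiffAt_tfield hZ hy u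
  have hc : ContDiffAt ℝ ∞ (fun q : E × E => cl g x₀ q.1) (y, u) :=
    ContDiffAt.comp (g := cl g x₀) (y, u) (cl_contDiffAt g hy) contDiffAt_fst
  exact h.fst.prodMk (h.snd.add ((hc.clm_apply contDiffAt_snd).clm_apply h.fst))

theorem contDiffAt_zetaC (hZ : Smooth (IT E) Z) (hy : y ∈ (extChartAt 𝓘(ℝ, E) x₀).target) (u : E) :
    ContDiffAt ℝ ∞ (zetaC g a b c x₀ Z) (y, u) :=
  ((contDiffAt_hv hZ hy u).fst.const_smul (a + c)).add ((contDiffAt_hv hZ hy u).snd.const_smul b)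

theorem contDiffAt_xiC (hZ : Smooth (IT E) Z) (hy : y ∈ (extChartAt 𝓘(ℝ, E) x₀).target) (u : E) :
    ContDiffAt ℝ ∞ (xiC g a b x₀ Z) (y, u) :=
  ((contDiffAt_hv hZ hy u).fst.const_smul b).add ((contDiffAt_hv hZ hy u).snd.const_smul a)

/-- A vector field on `TM` with prescribed horizontal and vertical parts at a point. -/
theorem exists_hv_eq (hy : y ∈ (extChartAt 𝓘(ℝ, E) x₀).target) (u : E) (V : E × E) :
    ∃ X : Π p : TM E M, TangentSpace (IT E) p, SmoothAt (IT E) X (pt x₀ (y, u)) ∧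
      hv g x₀ X (y, u) = V := by
  have hyu := mem_tangent_target (⟨x₀, 0⟩ : TM E M) hy u
  refine ⟨constField (IT E) (⟨x₀, 0⟩ : TM E M) (V.1, V.2 - cl g x₀ y u V.1),
    smoothAt_constField hyu _, ?_⟩
  have h := cfield_constField (J := IT E) hyu (V.1, V.2 - cl g x₀ y u V.1)
  have h' : tfield x₀ (constField (IT E) (⟨x₀, 0⟩ : TM E M) (V.1, V.2 - cl g x₀ y u V.1)) (y, u)
    = (V.1, V.2 - cl g x₀ y u V.1) := h
  rw [hv, vpart, h']
  simp

/-- The equation `𝓛_Z G = 2 μ G` at the point with coordinates `(y, u)`. -/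
def HomEq (g : Metric E M) (a b c μ : ℝ) (x₀ : M) (Z : Π p : TM E M, TangentSpace (IT E) p)
    (q : E × E) : Prop :=
  ∀ V W : E × E,
    gl g x₀ q.1 (covD (cl g x₀) (zetaC g a b c x₀ Z) q V) W.1
      + gl g x₀ q.1 (covD (cl g x₀) (xiC g a b x₀ Z) q V) W.2
      + (gl g x₀ q.1 (covD (cl g x₀) (zetaC g a b c x₀ Z) q W) V.1
      + gl g x₀ q.1 (covD (cl g x₀) (xiC g a b x₀ Z) q W) V.2)
    = 2 * μ * (a + c) * gl g x₀ q.1 V.1 W.1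
      + 2 * μ * b * (gl g x₀ q.1 V.1 W.2 + gl g x₀ q.1 V.2 W.1)
      + 2 * μ * a * gl g x₀ q.1 V.2 W.2

theorem homotheticWith_metricG_iff (hg : Flat g) (hZ : Smooth (IT E) Z) :
    HomotheticWith (IT E) (metricG g a b c) μ Z ↔
      ∀ (x₀ : M), ∀ y ∈ (extChartAt 𝓘(ℝ, E) x₀).target, ∀ u, HomEq g a b c μ x₀ Z (y, u) := by
  constructor
  · intro h x₀ y hy u V W
    obtain ⟨X, hX, rfl⟩ := exists_hv_eq (g := g) hy u V
    obtain ⟨Y, hY, rfl⟩ := exists_hv_eq (g := g) hy u W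
    have h1 := h (pt x₀ (y, u)) X Y hX hY
    rw [lieDeriv_metricG hg hy a b c (hZ _) hX hY, metricG_field g hy] at h1
    rw [h1, bigMetric]
    ring
  · intro h p V W hV hW
    obtain ⟨x, v, rfl⟩ : ∃ (x : M) (v : E), p = pt x (extChartAt 𝓘(ℝ, E) x x, v) :=
      ⟨p.1, p.2, (pt_center (E := E) p.1 p.2).symm⟩
    have hx := mem_extChartAt_target (I := 𝓘(ℝ, E)) x
    rw [lieDeriv_metricG hg hx a b c (hZ _) hV hW, metricG_field g hx, h x _ hx, bigMetric]
    ring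

theorem homotheticWith_metricTensor_iff {ζ : Π x : M, TangentSpace 𝓘(ℝ, E) x} {ν : ℝ}
    (hζ : Smooth 𝓘(ℝ, E) ζ) :
    HomotheticWith 𝓘(ℝ, E) (metricTensor g) ν ζ ↔
      ∀ (x₀ : M), ∀ y ∈ (extChartAt 𝓘(ℝ, E) x₀).target, ∀ v w,
        gl g x₀ y (covB (cl g x₀) (cfield 𝓘(ℝ, E) x₀ ζ) y v) w
          + gl g x₀ y (covB (cl g x₀) (cfield 𝓘(ℝ, E) x₀ ζ) y w) v = 2 * ν * gl g x₀ y v w := by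
  have := FiniteDimensional.complete ℝ E
  have hT : ∀ {x₀ : M} {y : E}, y ∈ (extChartAt 𝓘(ℝ, E) x₀).target →
      ∀ V W : Π x : M, TangentSpace 𝓘(ℝ, E) x,
      metricTensor g ((extChartAt 𝓘(ℝ, E) x₀).symm y) (V ((extChartAt 𝓘(ℝ, E) x₀).symm y))
        (W ((extChartAt 𝓘(ℝ, E) x₀).symm y))
      = gl g x₀ y (cfield 𝓘(ℝ, E) x₀ V y) (cfield 𝓘(ℝ, E) x₀ W y) := by
    intro x₀ y hy V W
    rw [gl_apply g hy, frame_cfield hy, frame_cfield hy]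
    rfl
  have key : ∀ {x₀ : M} {y : E}, y ∈ (extChartAt 𝓘(ℝ, E) x₀).target →
      ∀ V W : Π x : M, TangentSpace 𝓘(ℝ, E) x,
      SmoothAt 𝓘(ℝ, E) V ((extChartAt 𝓘(ℝ, E) x₀).symm y) →
      SmoothAt 𝓘(ℝ, E) W ((extChartAt 𝓘(ℝ, E) x₀).symm y) →
      lieDeriv 𝓘(ℝ, E) (metricTensor g) ζ V W ((extChartAt 𝓘(ℝ, E) x₀).symm y)
      = gl g x₀ y (covB (cl g x₀) (cfield 𝓘(ℝ, E) x₀ ζ) y (cfield 𝓘(ℝ, E) x₀ V y))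
          (cfield 𝓘(ℝ, E) x₀ W y)
        + gl g x₀ y (covB (cl g x₀) (cfield 𝓘(ℝ, E) x₀ ζ) y (cfield 𝓘(ℝ, E) x₀ W y))
          (cfield 𝓘(ℝ, E) x₀ V y) := by
    intro x₀ y hy V W hV hW
    obtain ⟨L, hL, hL'⟩ := fderiv_metric_fields (gl_differentiableAt g hy) (cl_compatAt g hy)
      ((hV.cfield hy).differentiableAt (by simp)) ((hW.cfield hy).differentiableAt (by simp))
    have hd : HasFDerivAt (fun z => metricTensor g ((extChartAt 𝓘(ℝ, E) x₀).symm z)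
        (V ((extChartAt 𝓘(ℝ, E) x₀).symm z)) (W ((extChartAt 𝓘(ℝ, E) x₀).symm z))) L y := by
      refine hL.congr_of_eventuallyEq ?_
      filter_upwards [extChartAt_target_mem_nhds_of_mem hy] with z hz using hT hz V W
    have hm := mvfderiv_eq hy (φ := fun q => metricTensor g q (V q) (W q)) hd
      (ζ ((extChartAt 𝓘(ℝ, E) x₀).symm y))
    have h1 := hT hy (VectorField.mlieBracket 𝓘(ℝ, E) ζ V) W
    have h2 := hT hy V (VectorField.mlieBracket 𝓘(ℝ, E) ζ W)
    rw [cfield_mlieBracket hy (hζ _) hV, lieBracket_eq_covB (cl_symm g hy)] at h1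
    rw [cfield_mlieBracket hy (hζ _) hW, lieBracket_eq_covB (cl_symm g hy)] at h2
    rw [lieDeriv]
    refine (congrArg₂ (· - ·) (congrArg₂ (· - ·) (hm.trans (hL' _)) h1) h2).trans ?_
    have e : cfield 𝓘(ℝ, E) x₀ ζ y = tangentCoordChange 𝓘(ℝ, E)
      ((extChartAt 𝓘(ℝ, E) x₀).symm y) x₀ ((extChartAt 𝓘(ℝ, E) x₀).symm y)
      (ζ ((extChartAt 𝓘(ℝ, E) x₀).symm y)) := rfl
    rw [← e, map_sub, map_sub, sub_apply, gl_symm g hy (cfield 𝓘(ℝ, E) x₀ V y)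
      (covB (cl g x₀) (cfield 𝓘(ℝ, E) x₀ ζ) y (cfield 𝓘(ℝ, E) x₀ W y))]
    ring
  constructor
  · intro h x₀ y hy v w
    have hV := smoothAt_constField (J := 𝓘(ℝ, E)) hy v
    have hW := smoothAt_constField (J := 𝓘(ℝ, E)) hy w
    have h1 := h _ _ _ hV hW
    rw [key hy _ _ hV hW, hT hy, cfield_constField hy, cfield_constField hy] at h1
    exact h1
  · intro h x V W hV hW
    have hx := mem_extChartAt_target (I := 𝓘(ℝ, E)) x
    have hp := extChartAt_to_inv (I := 𝓘(ℝ, E)) x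
    rw [← hp] at hV hW
    have h1 := key hx V W hV hW
    have h2 := hT hx V W
    rw [h x _ hx, ← h2] at h1
    rwa [hp] at h1

theorem skewNabla2_iff {ξ : Π x : M, TangentSpace 𝓘(ℝ, E) x} (hξ : Smooth 𝓘(ℝ, E) ξ) :
    SkewNabla2 g ξ ↔ ∀ (x₀ : M), ∀ y ∈ (extChartAt 𝓘(ℝ, E) x₀).target, ∀ u v,
      hessB (cl g x₀) (cfield 𝓘(ℝ, E) x₀ ξ) y u v
        + hessB (cl g x₀) (cfield 𝓘(ℝ, E) x₀ ξ) y v u = 0 := by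
  constructor
  · intro h x₀ y hy u v
    have hU := smoothAt_constField (J := 𝓘(ℝ, E)) hy u
    have hV := smoothAt_constField (J := 𝓘(ℝ, E)) hy v
    have h1 := cfield_nabla2 g hy (U := constField 𝓘(ℝ, E) x₀ u) (hξ _) hV
    have h2 := cfield_nabla2 g hy (U := constField 𝓘(ℝ, E) x₀ v) (hξ _) hU
    rw [cfield_constField hy, cfield_constField hy] at h1 h2
    rw [← h1, ← h2]
    have h3 := congrArg (fun w : E => tangentCoordChange 𝓘(ℝ, E)
      ((extChartAt 𝓘(ℝ, E) x₀).symm y) x₀ ((extChartAt 𝓘(ℝ, E) x₀).symm y) w) (h _ _ _ hU hV)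
    refine Eq.trans ?_ (h3.trans (map_zero _))
    exact (map_add (tangentCoordChange 𝓘(ℝ, E)
      ((extChartAt 𝓘(ℝ, E) x₀).symm y) x₀ ((extChartAt 𝓘(ℝ, E) x₀).symm y)) _ _).symm
  · intro h x U V hU hV
    have hx := mem_extChartAt_target (I := 𝓘(ℝ, E)) x
    have hp := extChartAt_to_inv (I := 𝓘(ℝ, E)) x
    have hU' := hU
    have hV' := hV
    rw [← hp] at hU' hV'
    have h1 := cfield_nabla2 g hx (U := U) (hξ _) hV'
    have h2 := cfield_nabla2 g hx (U := V) (hξ _) hU'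
    rw [cfield_center] at h1 h2
    exact (congrArg₂ (fun v w : E => v + w) h1 h2).trans (h x _ hx _ _)

/-- The matrix of a `(1,1)`-tensor field in the preferred chart at `x₀`. -/
def cend (x₀ : M) (P : Π x : M, TangentSpace 𝓘(ℝ, E) x →L[ℝ] TangentSpace 𝓘(ℝ, E) x) (z : E) :
    E →L[ℝ] E :=
  (tangentCoordChange 𝓘(ℝ, E) ((extChartAt 𝓘(ℝ, E) x₀).symm z) x₀
    ((extChartAt 𝓘(ℝ, E) x₀).symm z)).comp
    (ContinuousLinearMap.comp (P ((extChartAt 𝓘(ℝ, E) x₀).symm z) : E →L[ℝ] E)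
      (frame 𝓘(ℝ, E) x₀ z))

variable {P : Π x : M, TangentSpace 𝓘(ℝ, E) x →L[ℝ] TangentSpace 𝓘(ℝ, E) x}

theorem frame_cend (hy : y ∈ (extChartAt 𝓘(ℝ, E) x₀).target) (v : E) :
    frame 𝓘(ℝ, E) x₀ y (cend x₀ P y v)
      = P ((extChartAt 𝓘(ℝ, E) x₀).symm y) (frame 𝓘(ℝ, E) x₀ y v) :=
  frame_tangentCoordChange hy (P ((extChartAt 𝓘(ℝ, E) x₀).symm y) (frame 𝓘(ℝ, E) x₀ y v))

theorem cend_center (x : M) (v : E) : cend x P (extChartAt 𝓘(ℝ, E) x x) v = P x v := by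
  have h := frame_cend (P := P) (mem_extChartAt_target x) v
  rw [frame_center, frame_center] at h
  refine h.trans ?_
  rw [extChartAt_to_inv]

theorem cfield_end_apply (hy : y ∈ (extChartAt 𝓘(ℝ, E) x₀).target)
    (V : Π x : M, TangentSpace 𝓘(ℝ, E) x) :
    cfield 𝓘(ℝ, E) x₀ (fun x => P x (V x)) y = cend x₀ P y (cfield 𝓘(ℝ, E) x₀ V y) := by
  apply (frameEquiv hy).injective
  refine (frame_cfield hy _).trans (Eq.trans ?_ (frame_cend hy _).symm)
  rw [frame_cfield hy]

theorem smoothEnd_of_cend (h : ∀ x₀ : M, ContDiffAt ℝ ∞ (cend x₀ P) (extChartAt 𝓘(ℝ, E) x₀ x₀)) :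
    SmoothEnd P := by
  intro x₀
  have hx := mem_extChartAt_target (I := 𝓘(ℝ, E)) x₀
  have h1 := (trivializationAt (E →L[ℝ] E)
    (fun x : M => TangentSpace 𝓘(ℝ, E) x →L[ℝ] TangentSpace 𝓘(ℝ, E) x)
    x₀).contMDiffAt_section_iff (IB := 𝓘(ℝ, E)) (n := ∞) (s := P) (x₀ := x₀)
    (by simp)
  refine h1.2 ?_
  have h2 := (contMDiffAt_iff_chart (J := 𝓘(ℝ, E)) (n := ∞) le_rfl hx (φ := fun x =>
    (trivializationAt (E →L[ℝ] E)
    (fun x : M => TangentSpace 𝓘(ℝ, E) x →L[ℝ] TangentSpace 𝓘(ℝ, E) x) x₀ ⟨x, P x⟩).2)).2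
  rw [extChartAt_to_inv] at h2
  refine h2 ((h x₀).congr_of_eventuallyEq ?_)
  filter_upwards [extChartAt_target_mem_nhds_of_mem hx] with z hz
  have hq := (extChartAt 𝓘(ℝ, E) x₀).map_target hz
  rw [extChartAt_source] at hq
  rw [Function.comp_apply, cend]
  have := inTangentCoordinates_eq (I := 𝓘(ℝ, E)) (I' := 𝓘(ℝ, E)) (id : M → M) (id : M → M)
    (fun x => (P x : E →L[ℝ] E)) (x₀ := x₀) (x := (extChartAt 𝓘(ℝ, E) x₀).symm z) hq hq
  exact this

theorem parallelEnd_iff (hP : ∀ (x₀ : M), ∀ y ∈ (extChartAt 𝓘(ℝ, E) x₀).target,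
      ContDiffAt ℝ ∞ (cend x₀ P) y) :
    ParallelEnd g P ↔ ∀ (x₀ : M), ∀ y ∈ (extChartAt 𝓘(ℝ, E) x₀).target, ∀ v w,
      covB (cl g x₀) (fun z => cend x₀ P z w) y v = cend x₀ P y (cl g x₀ y v w) := by
  have key : ∀ {x₀ : M} {y : E}, y ∈ (extChartAt 𝓘(ℝ, E) x₀).target →
      ∀ U V : Π x : M, TangentSpace 𝓘(ℝ, E) x,
      SmoothAt 𝓘(ℝ, E) V ((extChartAt 𝓘(ℝ, E) x₀).symm y) →
      cfield 𝓘(ℝ, E) x₀ (fun x => nabla g U (fun y => P y (V y)) x - P x (nabla g U V x)) y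
        = covB (cl g x₀) (fun z => cend x₀ P z (cfield 𝓘(ℝ, E) x₀ V y)) y
            (cfield 𝓘(ℝ, E) x₀ U y)
          - cend x₀ P y (cl g x₀ y (cfield 𝓘(ℝ, E) x₀ U y) (cfield 𝓘(ℝ, E) x₀ V y)) := by
    intro x₀ y hy U V hV
    have hev : cfield 𝓘(ℝ, E) x₀ (fun x => P x (V x)) =ᶠ[𝓝 y]
        fun z => cend x₀ P z (cfield 𝓘(ℝ, E) x₀ V z) := by
      filter_upwards [extChartAt_target_mem_nhds_of_mem hy] with z hz using cfield_end_apply hz V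
    have hPV : SmoothAt 𝓘(ℝ, E) (fun x => P x (V x)) ((extChartAt 𝓘(ℝ, E) x₀).symm y) := by
      rw [smoothAt_iff hy]
      exact ((hP x₀ y hy).clm_apply (hV.cfield hy)).congr_of_eventuallyEq hev
    have h1 := cfield_nabla g hy (X := U) hPV.c1
    have h2 := cfield_end_apply (P := P) hy (nabla g U V)
    have hP1 : HasFDerivAt (cend x₀ P) _ y := ((hP x₀ y hy).differentiableAt (by simp)).hasFDerivAt
    have hV1 : HasFDerivAt (cfield 𝓘(ℝ, E) x₀ V) _ y :=
      ((hV.cfield hy).differentiableAt (by simp)).hasFDerivAt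
    refine (cfield_sub x₀ (nabla g U (fun y => P y (V y))) (fun x => P x (nabla g U V x)) y).trans ?_
    rw [h1, h2, cfield_nabla g hy hV.c1, covB, hev.fderiv_eq, hev.self_of_nhds,
      (hP1.clm_apply hV1).fderiv, covB, covB, (hP1.clm_apply (hasFDerivAt_const _ y)).fderiv]
    simp
    abel
  constructor
  · intro h x₀ y hy v w
    have hU := smoothAt_constField (J := 𝓘(ℝ, E)) hy v
    have hV := smoothAt_constField (J := 𝓘(ℝ, E)) hy w
    have h1 := key hy (constField 𝓘(ℝ, E) x₀ v) _ hV
    rw [cfield_constField hy, cfield_constField hy] at h1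
    rw [← sub_eq_zero, ← h1, cfield, h _ _ _ hU hV]
    exact map_zero _
  · intro h x U V hU hV
    have hx := mem_extChartAt_target (I := 𝓘(ℝ, E)) x
    have hp := extChartAt_to_inv (I := 𝓘(ℝ, E)) x
    rw [← hp] at hV
    have h1 := key hx U V hV
    rw [cfield_center, h x _ hx, sub_self] at h1
    exact h1

end Transfer

/-! ### Fields along the projection of the tangent bundle -/

section Along

variable {E : Type*} [NormedAddCommGroup E] [NormedSpace ℝ E] [FiniteDimensional ℝ E]
  {M : Type*} [TopologicalSpace M] [ChartedSpace E M] [IsManifold 𝓘(ℝ, E) ∞ M]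
  {g : Metric E M} {x₀ : M} {y u : E} {a b c μ : ℝ}
  {Z : Π p : TM E M, TangentSpace (IT E) p}

/-- The field `ζ` along the projection with `G(Z, Xʰ) = g(ζ, X)`. -/
def zetaT (g : Metric E M) (a b c : ℝ) (Z : Π p : TM E M, TangentSpace (IT E) p) (p : TM E M) :
    TangentSpace 𝓘(ℝ, E) p.1 := (a + c) • dproj p (Z p) + b • conn g p (Z p)

/-- The field `ξ` along the projection with `G(Z, Xᵛ) = g(ξ, X)`. -/
def xiT (g : Metric E M) (a b : ℝ) (Z : Π p : TM E M, TangentSpace (IT E) p) (p : TM E M) :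
    TangentSpace 𝓘(ℝ, E) p.1 := b • dproj p (Z p) + a • conn g p (Z p)

/-- The field `(x, u) ↦ X + Q u + r u` along the projection. -/
def affLift (X : Π x : M, TangentSpace 𝓘(ℝ, E) x)
    (Q : Π x : M, TangentSpace 𝓘(ℝ, E) x →L[ℝ] TangentSpace 𝓘(ℝ, E) x) (r : ℝ) (p : TM E M) :
    TangentSpace 𝓘(ℝ, E) p.1 := X p.1 + Q p.1 p.2 + r • p.2

theorem conn_add (p : TM E M) (w w' : TangentSpace (IT E) p) :
    conn g p (w + w') = conn g p w + conn g p w' := by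
  have h : christoffel g p.1 p.2 (Prod.fst (α := E) (β := E) (w + w'))
    = christoffel g p.1 p.2 (Prod.fst (α := E) (β := E) w)
      + christoffel g p.1 p.2 (Prod.fst (α := E) (β := E) w') := map_add _ _ _
  exact (congrArg (fun e : E => (w + w' : E × E).2 + e) h).trans (add_add_add_comm (G := E) _ _ _ _)

theorem conn_smul (p : TM E M) (r : ℝ) (w : TangentSpace (IT E) p) :
    conn g p (r • w) = r • conn g p w := by
  have h : christoffel g p.1 p.2 (Prod.fst (α := E) (β := E) (r • w))
    = r • christoffel g p.1 p.2 (Prod.fst (α := E) (β := E) w) := map_smul _ _ _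
  exact (congrArg (fun e : E => (r • w : E × E).2 + e) h).trans (smul_add (A := E) _ _ _).symm

theorem ext_dproj_conn (p : TM E M) {w w' : TangentSpace (IT E) p}
    (h1 : dproj p w = dproj p w') (h2 : conn g p w = conn g p w') : w = w' := by
  have h1' : Prod.fst (α := E) (β := E) w = Prod.fst (α := E) (β := E) w' := h1
  refine Prod.ext (α := E) (β := E) h1' ?_
  have h3 : (Prod.snd (α := E) (β := E) w + christoffel g p.1 p.2 (Prod.fst (α := E) (β := E) w))
    = Prod.snd (α := E) (β := E) w'
      + christoffel g p.1 p.2 (Prod.fst (α := E) (β := E) w') := h2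
  rw [h1'] at h3
  exact add_right_cancel h3

theorem dproj_homField {ζ ξ : Π x : M, TangentSpace 𝓘(ℝ, E) x}
    {P : Π x : M, TangentSpace 𝓘(ℝ, E) x →L[ℝ] TangentSpace 𝓘(ℝ, E) x} (p : TM E M) :
    dproj p (homField g a b c μ ζ P ξ p) = (a * (a + c) - b ^ 2)⁻¹ •
      ((a • ζ p.1 - b • ξ p.1)
        + (a • tensorC g ξ p.1 p.2 - b • P p.1 p.2 + (μ * a * b) • p.2)) := by
  have h : ∀ w₁ w₂ : TangentSpace 𝓘(ℝ, E) p.1, w₁ + w₂ + 0 + 0 = w₁ + w₂ := fun w₁ w₂ => by simp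
  exact congrArg (fun w : TangentSpace 𝓘(ℝ, E) p.1 => (a * (a + c) - b ^ 2)⁻¹ • w) (h _ _)

theorem conn_homField {ζ ξ : Π x : M, TangentSpace 𝓘(ℝ, E) x}
    {P : Π x : M, TangentSpace 𝓘(ℝ, E) x →L[ℝ] TangentSpace 𝓘(ℝ, E) x} (p : TM E M) :
    conn g p (homField g a b c μ ζ P ξ p) = (a * (a + c) - b ^ 2)⁻¹ •
      (((a + c) • ξ p.1 - b • ζ p.1)
        + ((a + c) • P p.1 p.2 - b • tensorC g ξ p.1 p.2
          + (μ * ((a * (a + c) - b ^ 2) - b ^ 2)) • p.2)) := by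
  rw [homField, conn_smul, conn_add, conn_add, conn_add, hLiftField, starLift, vLiftField,
    iotaLift, conn_hLift, conn_hLift, conn_vLift, conn_vLift, add_zero, zero_add]
  rfl

/-- Solving `zetaT = (a + c) Zʰ + b Zᵛ`, `xiT = b Zʰ + a Zᵛ` for the parts of `Z`: the form of `Z` in
the classification says that these two fields are affine on the fibres. -/
theorem eq_homField_iff (hα : a * (a + c) - b ^ 2 ≠ 0) {ζ ξ : Π x : M, TangentSpace 𝓘(ℝ, E) x}
    {P : Π x : M, TangentSpace 𝓘(ℝ, E) x →L[ℝ] TangentSpace 𝓘(ℝ, E) x} :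
    Z = homField g a b c μ ζ P ξ ↔
      (∀ p, zetaT g a b c Z p = affLift ζ (tensorC g ξ) (2 * μ * b) p) ∧
      ∀ p, xiT g a b Z p = affLift ξ P (μ * a) p := by
  constructor
  · rintro rfl
    refine ⟨fun p => ?_, fun p => ?_⟩
    · rw [zetaT, dproj_homField, conn_homField, affLift,
        ← inv_smul_smul₀ hα (ζ p.1 + tensorC g ξ p.1 p.2 + (2 * μ * b) • p.2)]
      module
    · rw [xiT, dproj_homField, conn_homField, affLift,
        ← inv_smul_smul₀ hα (ξ p.1 + P p.1 p.2 + (μ * a) • p.2)]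
      module
  · rintro ⟨h1, h2⟩
    funext p
    have e1 := h1 p
    have e2 := h2 p
    refine ext_dproj_conn (g := g) p ?_ ?_
    · have h : dproj p (Z p) = (a * (a + c) - b ^ 2)⁻¹ •
          (a • zetaT g a b c Z p - b • xiT g a b Z p) := by
        rw [← inv_smul_smul₀ hα (dproj p (Z p)), zetaT, xiT]
        congr 1
        module
      rw [h, e1, e2, dproj_homField, affLift, affLift]
      module
    · have h : conn g p (Z p) = (a * (a + c) - b ^ 2)⁻¹ •
          ((a + c) • xiT g a b Z p - b • zetaT g a b c Z p) := by
        rw [← inv_smul_smul₀ hα (conn g p (Z p)), zetaT, xiT]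
        congr 1
        module
      rw [h, e1, e2, conn_homField, affLift, affLift]
      module

/-- `C` is the expression in coordinates of the field `T` along the projection. -/
def IsExpr (T : Π p : TM E M, TangentSpace 𝓘(ℝ, E) p.1) (C : M → E × E → E) : Prop :=
  ∀ (x₀ : M), ∀ y ∈ (extChartAt 𝓘(ℝ, E) x₀).target, ∀ u,
    frame 𝓘(ℝ, E) x₀ y (C x₀ (y, u)) = T (pt x₀ (y, u))

theorem isExpr_zeta : IsExpr (zetaT g a b c Z) (fun x₀ => zetaC g a b c x₀ Z) := by
  intro x₀ y hy u
  change frame 𝓘(ℝ, E) x₀ y (zetaC g a b c x₀ Z (y, u)) = _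
  rw [zetaC, map_add, map_smul, map_smul, zetaT, dproj_field g hy, conn_field g hy]
  rfl

theorem isExpr_xi : IsExpr (xiT g a b Z) (fun x₀ => xiC g a b x₀ Z) := by
  intro x₀ y hy u
  change frame 𝓘(ℝ, E) x₀ y (xiC g a b x₀ Z (y, u)) = _
  rw [xiC, map_add, map_smul, map_smul, xiT, dproj_field g hy, conn_field g hy]
  rfl

variable {T : Π p : TM E M, TangentSpace 𝓘(ℝ, E) p.1} {C : M → E × E → E}

theorem IsExpr.frame_eq (h : IsExpr T C) (hy : y ∈ (extChartAt 𝓘(ℝ, E) x₀).target) (u : E) :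
    frame 𝓘(ℝ, E) x₀ y (C x₀ (y, u))
      = T ⟨(extChartAt 𝓘(ℝ, E) x₀).symm y, frame 𝓘(ℝ, E) x₀ y u⟩ :=
  (h x₀ y hy u).trans (congrArg (fun p : TM E M => (T p : E)) (pt_eq hy u))

theorem IsExpr.center (h : IsExpr T C) (x : M) (u : E) :
    T ⟨x, u⟩ = C x (extChartAt 𝓘(ℝ, E) x x, u) := by
  have h1 := h x _ (mem_extChartAt_target x) u
  rw [frame_center] at h1
  exact (h1.trans (congrArg (fun p : TM E M => (T p : E)) (pt_center x u))).symm

/-- The restriction to the zero section of a field along the projection. -/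
def restr (T : Π p : TM E M, TangentSpace 𝓘(ℝ, E) p.1) (x : M) : TangentSpace 𝓘(ℝ, E) x :=
  T ⟨x, 0⟩

/-- The vertical derivative, on the zero section, of a field along the projection. -/
def vertT (T : Π p : TM E M, TangentSpace 𝓘(ℝ, E) p.1) (x : M) :
    TangentSpace 𝓘(ℝ, E) x →L[ℝ] TangentSpace 𝓘(ℝ, E) x :=
  fderiv ℝ (fun u : E => (T (⟨x, u⟩ : TM E M) : E)) 0

theorem IsExpr.cfield_restr (h : IsExpr T C) (hy : y ∈ (extChartAt 𝓘(ℝ, E) x₀).target) :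
    cfield 𝓘(ℝ, E) x₀ (restr T) y = C x₀ (y, 0) := by
  apply (frameEquiv hy).injective
  refine (frame_cfield hy _).trans (Eq.trans ?_ (h.frame_eq hy 0).symm)
  rw [map_zero]
  rfl

theorem IsExpr.cend_vertT (h : IsExpr T C) (hy : y ∈ (extChartAt 𝓘(ℝ, E) x₀).target)
    (hC : DifferentiableAt ℝ (C x₀) (y, 0)) : cend x₀ (vertT T) y = vert (C x₀) y := by
  ext v
  apply (frameEquiv hy).injective
  refine (frame_cend hy v).trans ?_
  have h1 : HasFDerivAt (fun u : E => (T (⟨(extChartAt 𝓘(ℝ, E) x₀).symm y, u⟩ : TM E M) : E))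
      ((frame 𝓘(ℝ, E) x₀ y).comp ((vert (C x₀) y).comp ((frameEquiv hy).symm : E →L[ℝ] E))) 0 := by
    have h2 := hasFDerivAt_fibre hC
    have h3 : HasFDerivAt (fun u => C x₀ (y, u)) (vert (C x₀) y) ((frameEquiv hy).symm 0) := by
      rwa [map_zero]
    have h4 := (frame 𝓘(ℝ, E) x₀ y).hasFDerivAt.comp (0 : E)
      (h3.comp (0 : E) (frameEquiv hy).symm.hasFDerivAt)
    refine h4.congr_of_eventuallyEq (Eventually.of_forall fun u => ?_)
    have h5 := h.frame_eq hy ((frameEquiv hy).symm u)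
    have h6 : frame 𝓘(ℝ, E) x₀ y ((frameEquiv hy).symm u) = u := (frameEquiv hy).apply_symm_apply u
    rw [h6] at h5
    exact h5.symm
  rw [vertT]
  refine (congrArg (fun L : E →L[ℝ] E => L (frame 𝓘(ℝ, E) x₀ y v)) h1.fderiv).trans ?_
  have h7 : (frameEquiv hy).symm (frame 𝓘(ℝ, E) x₀ y v) = v := (frameEquiv hy).symm_apply_apply v
  simp only [ContinuousLinearMap.comp_apply, ContinuousLinearEquiv.coe_coe, h7]
  rfl

theorem IsExpr.eq_affine (h : IsExpr T C) {X : Π x : M, TangentSpace 𝓘(ℝ, E) x}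
    {Q : Π x : M, TangentSpace 𝓘(ℝ, E) x →L[ℝ] TangentSpace 𝓘(ℝ, E) x} {r : ℝ}
    (hT : ∀ p, T p = affLift X Q r p) (hy : y ∈ (extChartAt 𝓘(ℝ, E) x₀).target) (u : E) :
    C x₀ (y, u) = cfield 𝓘(ℝ, E) x₀ X y
      + (cend x₀ Q y + r • ContinuousLinearMap.id ℝ E) u := by
  apply (frameEquiv hy).injective
  refine (h.frame_eq hy u).trans ((hT _).trans ?_)
  have e : frameEquiv hy (cfield 𝓘(ℝ, E) x₀ X y
      + (cend x₀ Q y + r • ContinuousLinearMap.id ℝ E) u) = frame 𝓘(ℝ, E) x₀ y (cfield 𝓘(ℝ, E) x₀ X y)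
      + frame 𝓘(ℝ, E) x₀ y (cend x₀ Q y u) + r • frame 𝓘(ℝ, E) x₀ y u := by
    simp only [map_add, add_apply, smul_apply, ContinuousLinearMap.id_apply, map_smul, ← add_assoc]
    rfl
  rw [e, frame_cfield hy, frame_cend hy]
  rfl

theorem smooth_of_cfield {X : Π x : M, TangentSpace 𝓘(ℝ, E) x}
    (h : ∀ x, ContDiffAt ℝ ∞ (cfield 𝓘(ℝ, E) x X) (extChartAt 𝓘(ℝ, E) x x)) :
    Smooth 𝓘(ℝ, E) X := by
  intro x
  have h1 := (smoothAt_iff (mem_extChartAt_target (I := 𝓘(ℝ, E)) x)).2 (h x)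
  rwa [extChartAt_to_inv] at h1

theorem IsExpr.smooth_restr (h : IsExpr T C)
    (hC : ∀ (x₀ : M), ∀ y ∈ (extChartAt 𝓘(ℝ, E) x₀).target, ContDiffAt ℝ ∞ (C x₀) (y, 0)) :
    Smooth 𝓘(ℝ, E) (restr T) := by
  refine smooth_of_cfield fun x => ?_
  have hx := mem_extChartAt_target (I := 𝓘(ℝ, E)) x
  have h1 : ContDiffAt ℝ ∞ (fun z : E => C x (z, 0)) (extChartAt 𝓘(ℝ, E) x x) :=
    ContDiffAt.comp (g := C x) (extChartAt 𝓘(ℝ, E) x x) (hC x _ hx)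
      (contDiffAt_id.prodMk contDiffAt_const)
  refine h1.congr_of_eventuallyEq ?_
  filter_upwards [extChartAt_target_mem_nhds_of_mem hx] with z hz using h.cfield_restr hz

end Along

/-! ### The classification -/

section Classification

variable {E : Type*} [NormedAddCommGroup E] [NormedSpace ℝ E] [FiniteDimensional ℝ E]
  {M : Type*} [TopologicalSpace M] [ChartedSpace E M] [IsManifold 𝓘(ℝ, E) ∞ M]
  {g : Metric E M} {x₀ : M} {y u : E} {a b c μ : ℝ}
  {Z : Π p : TM E M, TangentSpace (IT E) p}

theorem cend_sub_smul_id (hy : y ∈ (extChartAt 𝓘(ℝ, E) x₀).target)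
    (Q : Π x : M, TangentSpace 𝓘(ℝ, E) x →L[ℝ] TangentSpace 𝓘(ℝ, E) x) (r : ℝ) :
    cend x₀ (Q - r • idEnd M E) y = cend x₀ Q y - r • ContinuousLinearMap.id ℝ E := by
  ext v
  apply (frameEquiv hy).injective
  refine (frame_cend hy v).trans (Eq.symm ?_)
  change frame 𝓘(ℝ, E) x₀ y (cend x₀ Q y v - r • v) = _
  rw [map_sub, map_smul, frame_cend hy]
  rfl

theorem hess_zetaC_xiC (hg : Flat g) (hZ : Smooth (IT E) Z)
    (h : ∀ y ∈ (extChartAt 𝓘(ℝ, E) x₀).target, ∀ u, HomEq g a b c μ x₀ Z (y, u))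
    (hy : y ∈ (extChartAt 𝓘(ℝ, E) x₀).target) (u : E) (V W : E × E) :
    hess (cl g x₀) (zetaC g a b c x₀ Z) (y, u) V W = 0 ∧
      hess (cl g x₀) (xiC g a b x₀ Z) (y, u) V W = 0 := by
  have h2 : (2 : ℕ∞ω) ≤ ∞ := ENat.natCast_le_of_coe_top_le_withTop le_rfl 2
  refine hess_eq_zero (A := 2 * μ * (a + c)) (B := 2 * μ * b) (C := 2 * μ * a) (G := gl g x₀)
    ((contDiffAt_zetaC hZ hy u).of_le h2)
    ((contDiffAt_xiC hZ hy u).of_le h2) (cl_differentiableAt g hy) (cl_symm_eventually g hy)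
    (hg.flatAt hy) (gl_differentiableAt g hy) (cl_compatAt g hy) (gl_nondegenerate g hy) ?_ V W
  filter_upwards [(continuous_fst (X := E) (Y := E)).continuousAt (x := (y, u)) |>.eventually
    (extChartAt_target_mem_nhds_of_mem hy)] with q hq using h q.1 hq q.2

theorem HomEq.horizontal (hZ : Smooth (IT E) Z) (hy : y ∈ (extChartAt 𝓘(ℝ, E) x₀).target)
    (h : HomEq g a b c μ x₀ Z (y, 0)) (v w : E) :
    gl g x₀ y (covB (cl g x₀) (fun z => zetaC g a b c x₀ Z (z, 0)) y v) w
      + gl g x₀ y (covB (cl g x₀) (fun z => zetaC g a b c x₀ Z (z, 0)) y w) v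
      = 2 * (μ * (a + c)) * gl g x₀ y v w := by
  have h1 := h (v, 0) (w, 0)
  have hd := (contDiffAt_zetaC (g := g) (a := a) (b := b) (c := c) hZ hy 0).differentiableAt
    (by simp)
  rw [covD_horizontal hd, covD_horizontal hd] at h1
  simp only [map_zero, zero_apply] at h1
  linarith

theorem HomEq.mixed (hZ : Smooth (IT E) Z) (hy : y ∈ (extChartAt 𝓘(ℝ, E) x₀).target)
    (h : HomEq g a b c μ x₀ Z (y, 0)) (v w : E) :
    gl g x₀ y (covB (cl g x₀) (fun z => xiC g a b x₀ Z (z, 0)) y v) w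
      + gl g x₀ y (vert (zetaC g a b c x₀ Z) y w) v = 2 * μ * b * gl g x₀ y v w := by
  have h1 := h (v, 0) (0, w)
  have hd := (contDiffAt_xiC (g := g) (a := a) (b := b) hZ hy 0).differentiableAt (by simp)
  rw [covD_horizontal hd] at h1
  simp only [map_zero, zero_apply, covD_vertical, ← vert_apply] at h1
  linarith

theorem HomEq.vertical (h : HomEq g a b c μ x₀ Z (y, 0)) (v w : E) :
    gl g x₀ y (vert (xiC g a b x₀ Z) y v) w + gl g x₀ y (vert (xiC g a b x₀ Z) y w) v
      = 2 * μ * a * gl g x₀ y v w := by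
  have h1 := h (0, v) (0, w)
  simp only [map_zero, zero_apply, covD_vertical, ← vert_apply] at h1
  linarith

/-- A homothetic field has the form of the classification: `ζ` and `ξ` are the restrictions of the
two associated fields to the zero section, and `P` is the vertical derivative of the second one,
corrected by a multiple of the identity. -/
theorem HomotheticWith.hasHomForm (hg : Flat g) (hα : a * (a + c) - b ^ 2 ≠ 0)
    (hZ : Smooth (IT E) Z) (hK : HomotheticWith (IT E) (metricG g a b c) μ Z) :
    HasHomForm g a b c μ Z := by
  have h2 : (2 : ℕ∞ω) ≤ ∞ := ENat.natCast_le_of_coe_top_le_withTop le_rfl 2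
  have h := (homotheticWith_metricG_iff hg hZ).1 hK
  have Hζ := isExpr_zeta (g := g) (a := a) (b := b) (c := c) (Z := Z)
  have Hξ := isExpr_xi (g := g) (a := a) (b := b) (Z := Z)
  have cζ : ∀ (x₀ : M), ∀ y ∈ (extChartAt 𝓘(ℝ, E) x₀).target,
      ContDiffAt ℝ ∞ (zetaC g a b c x₀ Z) (y, 0) := fun x₀ y hy => contDiffAt_zetaC hZ hy 0
  have cξ : ∀ (x₀ : M), ∀ y ∈ (extChartAt 𝓘(ℝ, E) x₀).target,
      ContDiffAt ℝ ∞ (xiC g a b x₀ Z) (y, 0) := fun x₀ y hy => contDiffAt_xiC hZ hy 0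
  have sζ : Smooth 𝓘(ℝ, E) (restr (zetaT g a b c Z)) := Hζ.smooth_restr cζ
  have sξ : Smooth 𝓘(ℝ, E) (restr (xiT g a b Z)) := Hξ.smooth_restr cξ
  have rζ : ∀ (x₀ : M), ∀ y ∈ (extChartAt 𝓘(ℝ, E) x₀).target,
      cfield 𝓘(ℝ, E) x₀ (restr (zetaT g a b c Z)) =ᶠ[𝓝 y] fun z => zetaC g a b c x₀ Z (z, 0) := by
    intro x₀ y hy
    filter_upwards [extChartAt_target_mem_nhds_of_mem hy] with z hz using Hζ.cfield_restr hz
  have rξ : ∀ (x₀ : M), ∀ y ∈ (extChartAt 𝓘(ℝ, E) x₀).target,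
      cfield 𝓘(ℝ, E) x₀ (restr (xiT g a b Z)) =ᶠ[𝓝 y] fun z => xiC g a b x₀ Z (z, 0) := by
    intro x₀ y hy
    filter_upwards [extChartAt_target_mem_nhds_of_mem hy] with z hz using Hξ.cfield_restr hz
  have eP : ∀ (x₀ : M), ∀ y ∈ (extChartAt 𝓘(ℝ, E) x₀).target,
      cend x₀ (vertT (xiT g a b Z) - (μ * a) • idEnd M E) y
        = vert (xiC g a b x₀ Z) y - (μ * a) • ContinuousLinearMap.id ℝ E := by
    intro x₀ y hy
    rw [cend_sub_smul_id hy, Hξ.cend_vertT hy ((cξ x₀ y hy).differentiableAt (by simp))]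
  have eP' : ∀ (x₀ : M), ∀ y ∈ (extChartAt 𝓘(ℝ, E) x₀).target,
      cend x₀ (vertT (xiT g a b Z) - (μ * a) • idEnd M E)
        =ᶠ[𝓝 y] fun z => vert (xiC g a b x₀ Z) z - (μ * a) • ContinuousLinearMap.id ℝ E := by
    intro x₀ y hy
    filter_upwards [extChartAt_target_mem_nhds_of_mem hy] with z hz using eP x₀ z hz
  have sP : ∀ (x₀ : M), ∀ y ∈ (extChartAt 𝓘(ℝ, E) x₀).target,
      ContDiffAt ℝ ∞ (cend x₀ (vertT (xiT g a b Z) - (μ * a) • idEnd M E)) y := fun x₀ y hy =>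
    ((contDiffAt_vert (cξ x₀ y hy)).sub contDiffAt_const).congr_of_eventuallyEq (eP' x₀ y hy)
  refine ⟨restr (zetaT g a b c Z), vertT (xiT g a b Z) - (μ * a) • idEnd M E,
    restr (xiT g a b Z), ⟨sζ, ?_⟩, ⟨?_, ?_, ?_⟩, ⟨sξ, ?_⟩, ?_⟩
  · refine (homotheticWith_metricTensor_iff sζ).2 fun x₀ y hy v w => ?_
    rw [covB_congr (rζ x₀ y hy), covB_congr (rζ x₀ y hy)]
    exact (h x₀ y hy 0).horizontal hZ hy v w
  · exact smoothEnd_of_cend fun x₀ => sP x₀ _ (mem_extChartAt_target x₀)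
  · intro x v w
    change E at v w
    have hx := mem_extChartAt_target (I := 𝓘(ℝ, E)) x
    have hP : ∀ v : E, ((vertT (xiT g a b Z) - (μ * a) • idEnd M E) x v : E)
        = vert (xiC g a b x Z) (extChartAt 𝓘(ℝ, E) x x) v - (μ * a) • v := fun v => by
      refine (cend_center x v).symm.trans ?_
      rw [eP x _ hx]
      rfl
    have key : ∀ v w : E, g.inner x ((vertT (xiT g a b Z) - (μ * a) • idEnd M E) x v) w
        = gl g x (extChartAt 𝓘(ℝ, E) x x) (vert (xiC g a b x Z) (extChartAt 𝓘(ℝ, E) x x) v) w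
          - μ * a * gl g x (extChartAt 𝓘(ℝ, E) x x) v w := fun v w => by
      refine (congrArg₂ (fun (B : E →L[ℝ] E →L[ℝ] ℝ) (e : E) => B e w)
        (gl_center g x).symm (hP v)).trans ?_
      simp only [map_sub, sub_apply, map_smul, smul_apply, smul_eq_mul]
    refine (key v w).trans (Eq.trans ?_ (congrArg Neg.neg ((key w v).symm.trans (g.symm x _ _))))
    have h1 := (h x _ hx 0).vertical v w
    have h3 := congrArg (μ * a * ·) (gl_symm g hx v w)
    linarith
  · refine (parallelEnd_iff sP).2 fun x₀ y hy v w => ?_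
    have h1 := (hess_zetaC_xiC hg hZ (h x₀) hy 0 (v, 0) (0, w)).2
    rw [hess_mixed ((cξ x₀ y hy).of_le h2) (cl_differentiableAt g hy)] at h1
    have hd : DifferentiableAt ℝ (fun z => vert (xiC g a b x₀ Z) z w) y :=
      ((contDiffAt_vert (cξ x₀ y hy)).differentiableAt (by simp)).clm_apply
        (differentiableAt_const w)
    have hev : (fun z => cend x₀ (vertT (xiT g a b Z) - (μ * a) • idEnd M E) z w)
        =ᶠ[𝓝 y] fun z => vert (xiC g a b x₀ Z) z w - (μ * a) • w :=
      (eP' x₀ y hy).mono fun z hz => congrArg (fun L : E →L[ℝ] E => L w) hz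
    rw [covB_congr hev, eP x₀ y hy, covB, fderiv_sub_const, map_sub, map_smul]
    rw [covB, sub_eq_zero] at h1
    rw [← add_sub_assoc, h1]
    rfl
  · refine (skewNabla2_iff sξ).2 fun x₀ y hy u v => ?_
    have key : ∀ u v, hessB (cl g x₀) (cfield 𝓘(ℝ, E) x₀ (restr (xiT g a b Z))) y u v = 0 := by
      intro u v
      have h1 := (hess_zetaC_xiC hg hZ (h x₀) hy 0 (u, 0) (v, 0)).2
      rw [hess_horizontal ((cξ x₀ y hy).of_le h2) (cl_differentiableAt g hy)] at h1
      rw [← h1, hessB_congr (rξ x₀ y hy)]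
    rw [key, key, add_zero]
  · refine (eq_homField_iff hα).2 ⟨?_, ?_⟩
    · rintro ⟨x, u⟩
      change E at u
      have hx := mem_extChartAt_target (I := 𝓘(ℝ, E)) x
      have h1 := eq_affine_of_hess_vertical (fun u => (contDiffAt_zetaC hZ hx u).of_le h2)
        (fun u v w => (hess_zetaC_xiC (a := a) (b := b) (c := c) hg hZ (h x) hx u
          (0, v) (0, w)).1) u
      -- `t` is `C(ξ) u` seen as a vector of `E`, as `TangentSpace` carries no norm
      obtain ⟨t, ht⟩ : ∃ t : E, t = tensorC g (restr (xiT g a b Z)) x u := ⟨_, rfl⟩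
      have h3 : vert (zetaC g a b c x Z) (extChartAt 𝓘(ℝ, E) x x) u = t + (2 * μ * b) • u := by
        rw [← sub_eq_zero]
        refine gl_nondegenerate g hx _ fun v => ?_
        have h4 := (h x _ hx 0).mixed hZ hx v u
        have h5 : gl g x (extChartAt 𝓘(ℝ, E) x x) t v = -gl g x (extChartAt 𝓘(ℝ, E) x x) u
            (covB (cl g x) (fun z => xiC g a b x Z (z, 0)) (extChartAt 𝓘(ℝ, E) x x) v) := by
          rw [← covB_congr (rξ x _ hx), ← cov_eq_center g (SmoothAt.c1 (sξ x)), gl_center g x, ht]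
          exact inner_tensorC g (restr (xiT g a b Z)) x u v
        have h6 := gl_symm g hx u
          (covB (cl g x) (fun z => xiC g a b x Z (z, 0)) (extChartAt 𝓘(ℝ, E) x x) v)
        rw [gl_symm g hx v u] at h4
        simp only [map_sub, map_add, map_smul, sub_apply, add_apply, smul_apply, smul_eq_mul]
        linarith
      rw [h3] at h1
      refine (Hζ.center x u).trans (h1.trans ?_)
      rw [← Hζ.center x 0, ht]
      exact (add_assoc (G := E) _ _ _).symm
    · rintro ⟨x, u⟩
      change E at u
      have hx := mem_extChartAt_target (I := 𝓘(ℝ, E)) x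
      have h1 := eq_affine_of_hess_vertical (fun u => (contDiffAt_xiC hZ hx u).of_le h2)
        (fun u v w => (hess_zetaC_xiC (a := a) (b := b) (c := c) hg hZ (h x) hx u
          (0, v) (0, w)).2) u
      refine (Hξ.center x u).trans (h1.trans ?_)
      have h3 : vert (xiC g a b x Z) (extChartAt 𝓘(ℝ, E) x x) u - (μ * a) • u = _ :=
        (DFunLike.congr_fun (eP x _ hx) u).symm.trans (cend_center x u)
      have h4 := eq_add_of_sub_eq (G := E) h3
      rw [h4, ← Hξ.center x 0]
      exact (add_assoc (G := E) _ _ _).symm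

/-- If a smooth field along the projection is affine on the fibres, then its linear part is
smooth, being determined by the vertical derivative on the zero section. -/
theorem IsExpr.contDiffAt_cend {T : Π p : TM E M, TangentSpace 𝓘(ℝ, E) p.1} {C : M → E × E → E}
    {X : Π x : M, TangentSpace 𝓘(ℝ, E) x}
    {Q : Π x : M, TangentSpace 𝓘(ℝ, E) x →L[ℝ] TangentSpace 𝓘(ℝ, E) x} {r : ℝ}
    (h : IsExpr T C) (hT : ∀ p, T p = affLift X Q r p)
    (hC : ∀ z ∈ (extChartAt 𝓘(ℝ, E) x₀).target, ContDiffAt ℝ ∞ (C x₀) (z, 0))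
    (hy : y ∈ (extChartAt 𝓘(ℝ, E) x₀).target) : ContDiffAt ℝ ∞ (cend x₀ Q) y := by
  have h1 : ContDiffAt ℝ ∞ (fun z => vert (C x₀) z - r • ContinuousLinearMap.id ℝ E) y :=
    (contDiffAt_vert (hC y hy)).sub contDiffAt_const
  refine h1.congr_of_eventuallyEq ?_
  filter_upwards [extChartAt_target_mem_nhds_of_mem hy] with z hz
  rw [vert_eq_of_affine ((hC z hz).differentiableAt (by simp)) (h.eq_affine hT hz),
    add_sub_cancel_right]

theorem gl_tensorC {ξ : Π x : M, TangentSpace 𝓘(ℝ, E) x} (hξ : Smooth 𝓘(ℝ, E) ξ)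
    (hy : y ∈ (extChartAt 𝓘(ℝ, E) x₀).target) (v w : E) :
    gl g x₀ y (cend x₀ (tensorC g ξ) y v) w
      = -gl g x₀ y v (covB (cl g x₀) (cfield 𝓘(ℝ, E) x₀ ξ) y w) := by
  rw [gl_apply g hy, gl_apply g hy, frame_cend hy, ← cov_eq g hy (SmoothAt.c1 (hξ _))]
  exact inner_tensorC g ξ _ _ _

theorem SkewEnd.gl_cend {P : Π x : M, TangentSpace 𝓘(ℝ, E) x →L[ℝ] TangentSpace 𝓘(ℝ, E) x}
    (hP : SkewEnd g P) (hy : y ∈ (extChartAt 𝓘(ℝ, E) x₀).target) (v w : E) :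
    gl g x₀ y (cend x₀ P y v) w = -gl g x₀ y v (cend x₀ P y w) := by
  rw [gl_apply g hy, gl_apply g hy, frame_cend hy, frame_cend hy]
  exact hP _ _ _

/-- A field on `TM` of the form of the classification is homothetic. -/
theorem HasHomForm.homotheticWith (hg : Flat g) (hα : a * (a + c) - b ^ 2 ≠ 0)
    (hZ : Smooth (IT E) Z) (hF : HasHomForm g a b c μ Z) :
    HomotheticWith (IT E) (metricG g a b c) μ Z := by
  have h2 : (2 : ℕ∞ω) ≤ ∞ := ENat.natCast_le_of_coe_top_le_withTop le_rfl 2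
  have h1 : (1 : ℕ∞ω) ≤ ∞ := ENat.natCast_le_of_coe_top_le_withTop le_rfl 1
  obtain ⟨ζ, P, ξ, ⟨sζ, kζ⟩, ⟨-, skP, pP⟩, ⟨sξ, kξ⟩, hF⟩ := hF
  obtain ⟨Tζ, Tξ⟩ := (eq_homField_iff hα).1 hF
  have Hζ := isExpr_zeta (g := g) (a := a) (b := b) (c := c) (Z := Z)
  have Hξ := isExpr_xi (g := g) (a := a) (b := b) (Z := Z)
  have sC : ∀ (x₀ : M), ∀ y ∈ (extChartAt 𝓘(ℝ, E) x₀).target,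
      ContDiffAt ℝ ∞ (cend x₀ (tensorC g ξ)) y := fun x₀ y hy =>
    Hζ.contDiffAt_cend Tζ (fun z hz => contDiffAt_zetaC hZ hz 0) hy
  have sP : ∀ (x₀ : M), ∀ y ∈ (extChartAt 𝓘(ℝ, E) x₀).target,
      ContDiffAt ℝ ∞ (cend x₀ P) y := fun x₀ y hy =>
    Hξ.contDiffAt_cend Tξ (fun z hz => contDiffAt_xiC hZ hz 0) hy
  refine (homotheticWith_metricG_iff hg hZ).2 fun x₀ y hy u => ?_
  -- skew-symmetric by assumption and symmetric by flatness
  have hess : ∀ v w, hessB (cl g x₀) (cfield 𝓘(ℝ, E) x₀ ξ) y v w = 0 := fun v w => by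
    have h3 := (skewNabla2_iff sξ).1 kξ x₀ y hy v w
    rw [hg.hessB_symm hy (sξ _) w v, ← two_smul ℝ] at h3
    exact (smul_eq_zero.1 h3).resolve_left two_ne_zero
  have cX := (SmoothAt.cfield hy (sξ ((extChartAt 𝓘(ℝ, E) x₀).symm y)))
  have pC : ∀ v w, covB (cl g x₀) (fun z => cend x₀ (tensorC g ξ) z w) y v
      = cend x₀ (tensorC g ξ) y (cl g x₀ y v w) := fun v w => by
    refine parallel_of_adjoint (gl_differentiableAt g hy) (cl_compatAt g hy)
      (gl_nondegenerate g hy) ((cl_contDiffAt g hy).of_le h1) (cX.of_le h2)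
      ((sC x₀ y hy).differentiableAt (by simp)) ?_ hess v w
    filter_upwards [extChartAt_target_mem_nhds_of_mem hy] with z hz u w
    exact gl_tensorC sξ hz u w
  have dζ := covD_affine (u := u) ((eventually_of_mem (extChartAt_target_mem_nhds_of_mem hy)
      fun z hz => Hζ.eq_affine Tζ hz))
    ((SmoothAt.cfield hy (sζ _)).differentiableAt (by simp))
    (((sC x₀ y hy).differentiableAt (by simp)).add (differentiableAt_const _))
    (parallel_add_smul_id (2 * μ * b) pC) (cl_symm g hy)
  have dξ := covD_affine (u := u) ((eventually_of_mem (extChartAt_target_mem_nhds_of_mem hy)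
      fun z hz => Hξ.eq_affine Tξ hz))
    (cX.differentiableAt (by simp))
    (((sP x₀ y hy).differentiableAt (by simp)).add (differentiableAt_const _))
    (parallel_add_smul_id (μ * a) ((parallelEnd_iff sP).1 pP x₀ y hy)) (cl_symm g hy)
  intro V W
  have k1 := (homotheticWith_metricTensor_iff sζ).1 kζ x₀ y hy V.1 W.1
  have k2 := gl_tensorC (g := g) sξ hy V.2 W.1
  have k3 := gl_tensorC (g := g) sξ hy W.2 V.1
  have k4 := skP.gl_cend hy V.2 W.2
  rw [gl_symm g hy V.2 (covB _ _ _ _)] at k2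
  rw [gl_symm g hy W.2 (covB _ _ _ _)] at k3
  rw [gl_symm g hy V.2 (cend _ _ _ _)] at k4
  rw [dζ, dξ, dζ, dξ]
  simp only [map_add, add_apply, smul_apply, ContinuousLinearMap.id_apply, map_smul, smul_eq_mul]
  rw [gl_symm g hy W.2 V.1, gl_symm g hy W.2 V.2]
  linear_combination k1 + k2 + k3 + k4

end Classification

end FlatTangent

end

open FlatTangent in
theorem mainTheorem4 {E : Type*} [NormedAddCommGroup E] [NormedSpace ℝ E] [FiniteDimensional ℝ E]
    {M : Type*} [TopologicalSpace M] [T2Space M] [ChartedSpace E M] [IsManifold 𝓘(ℝ, E) ∞ M]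
    (g : Metric E M) (hflat : Flat g) (a b c : ℝ) (hα : a * (a + c) - b ^ 2 ≠ 0)
    (Z : Π p : TM E M, TangentSpace (IT E) p) (hZ : Smooth (IT E) Z) :
    (Homothetic (IT E) (metricG g a b c) Z ↔ ∃ μ : ℝ, HasHomForm g a b c μ Z) ∧
    ∀ μ : ℝ, HomotheticWith (IT E) (metricG g a b c) μ Z ↔ HasHomForm g a b c μ Z := by
  have h : ∀ μ : ℝ, HomotheticWith (IT E) (metricG g a b c) μ Z ↔ HasHomForm g a b c μ Z :=
    fun μ => ⟨HomotheticWith.hasHomForm hflat hα hZ, HasHomForm.homotheticWith hflat hα hZ⟩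
  exact ⟨exists_congr h, h⟩
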